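/- A topological dynamical system (TDS) is a pair $(X,T)$ with $X$ a non-empty compact metric space and $T:X\to X$ a homeomorphism. For non-empty open $U,V\subset X$ put $N(U,V)=\{n\in\mathbb Z:\ T^n(U)\cap V\neq\emptyset\}$. For a family $\mathcal F$ of subsets of $\mathbb Z$, $(X,T)$ is $\mathcal F$-transitive if $N(U,V)\in\mathcal F$ for all non-empty open $U,V\subset X$, and $\mathcal F$-mixing if $(X\times X,T\times T)$ is $\mathcal F$-transitive; it is weakly mixing if all return times sets $N(U,V)$ of $(X\times X,T\times T)$ are non-empty. The dual $\mathcal F^*$ of $\mathcal F$ consists of all subsets of $\mathbb Z$ that meet every member of $\mathcal F$, and $\mathcal F-\mathcal F$ consists of all subsets of $\mathbb Z$ containing $\{a-b:\ a,b\in F,\ a\ne b\}$ for some $F\in\mathcal F$. The upper Banach density of $A\subset\mathbb Z$ is $d^*(A)=\limsup_{M-N\to\infty}\frac{|A\cap[N,M]|}{M-N+1}$. Let $\mathcal C$ be the family of central sets, i.e. members of minimal idempotents of $\beta\mathbb Z$, and let $\mathcal D$ be the family of $D$-sets, i.e. members of idempotents of $\beta\mathbb Z$ all of whose members have positive upper Banach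 density. A finite open cover of $X$ is non-trivial if none of its elements is dense in $X$. $(X,T)$ is strong scattering if for every finite non-trivial open cover $\mathcal U$ of $X$ and every set $A=\{a_1<a_2<\cdots\}$ of positive integers with $d^*(A)>0$, the least cardinality of a subcover of $\bigvee_{i=1}^nT^{-a_i}\mathcal U$ tends to $\infty$ as $n\to\infty$. **Theorem.** The class of $\mathcal C^*$-mixing TDS is a proper subclass of the class of $(\mathcal D-\mathcal D)^*$-transitive TDS. That is: 1. every $\mathcal C^*$-mixing TDS is $(\mathcal D-\mathcal D)^*$-transitive; 2. there is a $(\mathcal D-\mathcal D)^*$-transitive TDS that is not weakly mixing and not $\mathcal C^*$-mixing. Moreover, a TDS is $(\mathcal D-\mathcal D)^*$-transitive if and only if it is strong scattering (so the system in 2 is strong scattering). -/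

import Mathlib

universe u

namespace TopMixing


section Families

/-- The dual of a family `ℱ` of sets of integers: all sets meeting every member of `ℱ`. -/
def dual (ℱ : Set (Set ℤ)) : Set (Set ℤ) :=
  {G | ∀ A ∈ ℱ, (G ∩ A).Nonempty}

/-- The set `S - S` of (non-zero) differences of elements of `S`. -/
def diffSet (S : Set ℤ) : Set ℤ :=
  {d | ∃ a ∈ S, ∃ b ∈ S, a ≠ b ∧ a - b = d}

/-- The family `ℱ - ℱ`: all sets containing the difference set of some member of `ℱ`. -/
def diffFamily (ℱ : Set (Set ℤ)) : Set (Set ℤ) :=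
  {A | ∃ S ∈ ℱ, diffSet S ⊆ A}

/-- The upper Banach density
`d*(A) = limsup_{M - N → ∞} |A ∩ [N, M]| / (M - N + 1)`. -/
noncomputable def upperBanachDensity (A : Set ℤ) : ℝ :=
  Filter.limsup
    (fun p : ℤ × ℤ => ((A ∩ Set.Icc p.1 p.2).ncard : ℝ) / ((p.2 - p.1 + 1 : ℤ) : ℝ))
    (Filter.comap (fun p : ℤ × ℤ => p.2 - p.1) Filter.atTop)

/-- The family of sets of positive upper Banach density. -/
def posUpperBanach : Set (Set ℤ) :=
  {A | 0 < upperBanachDensity A}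

attribute [local instance] Ultrafilter.add

/-- `p` is an idempotent of `βℤ`, the space of ultrafilters on `ℤ` with the addition
`A ∈ p + q ↔ ∀ᶠ m in p, ∀ᶠ n in q, m + n ∈ A`. -/
def IsIdempotent (p : Ultrafilter ℤ) : Prop :=
  p + p = p

/-- `L` is a left ideal of `βℤ`. -/
def IsLeftIdeal (L : Set (Ultrafilter ℤ)) : Prop :=
  L.Nonempty ∧ ∀ q : Ultrafilter ℤ, ∀ p ∈ L, q + p ∈ L

/-- `L` is a minimal left ideal of `βℤ`. -/
def IsMinimalLeftIdeal (L : Set (Ultrafilter ℤ)) : Prop :=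
  IsLeftIdeal L ∧ ∀ J : Set (Ultrafilter ℤ), IsLeftIdeal J → J ⊆ L → J = L

/-- `p` is a minimal idempotent of `βℤ`: an idempotent lying in a minimal left ideal. -/
def IsMinimalIdempotent (p : Ultrafilter ℤ) : Prop :=
  IsIdempotent p ∧ ∃ L : Set (Ultrafilter ℤ), IsMinimalLeftIdeal L ∧ p ∈ L

/-- The family `𝒞` of central sets (`C`-sets): members of minimal idempotents of `βℤ`. -/
def centralSets : Set (Set ℤ) :=
  {A | ∃ p : Ultrafilter ℤ, IsMinimalIdempotent p ∧ A ∈ p}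

/-- The family `𝒟` of `D`-sets: members of idempotents of `βℤ` all of whose members have
positive upper Banach density. -/
def dSets : Set (Set ℤ) :=
  {A | ∃ p : Ultrafilter ℤ, IsIdempotent p ∧ (∀ B ∈ p, B ∈ posUpperBanach) ∧ A ∈ p}

end Families

section Systems

/-- The return times set `N(U, V) = {n ∈ ℤ : Tⁿ U ∩ V ≠ ∅}`. -/
def returnTimes {X : Type u} [TopologicalSpace X] (T : X ≃ₜ X) (U V : Set X) : Set ℤ :=
  {n | (((T ^ n : X ≃ₜ X) '' U) ∩ V).Nonempty}

/-- `(X, T)` is `ℱ`-transitive: `N(U, V) ∈ ℱ` for all non-empty open `U`, `V`. -/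
def FTransitive (ℱ : Set (Set ℤ)) {X : Type u} [TopologicalSpace X] (T : X ≃ₜ X) : Prop :=
  ∀ U V : Set X, IsOpen U → U.Nonempty → IsOpen V → V.Nonempty → returnTimes T U V ∈ ℱ

/-- `(X, T)` is `ℱ`-mixing: `(X × X, T × T)` is `ℱ`-transitive. -/
def FMixing (ℱ : Set (Set ℤ)) {X : Type u} [TopologicalSpace X] (T : X ≃ₜ X) : Prop :=
  FTransitive ℱ (T.prodCongr T)

/-- `(X, T)` is transitive: `N(U, V) ≠ ∅` for all non-empty open `U`, `V`. -/
def Transitive {X : Type u} [TopologicalSpace X] (T : X ≃ₜ X) : Prop :=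
  ∀ U V : Set X, IsOpen U → U.Nonempty → IsOpen V → V.Nonempty → (returnTimes T U V).Nonempty

/-- `(X, T)` is weakly mixing: `(X × X, T × T)` is transitive. -/
def WeakMixing {X : Type u} [TopologicalSpace X] (T : X ≃ₜ X) : Prop :=
  Transitive (T.prodCongr T)

/-- A finite non-trivial open cover: finitely many open sets, none of them dense, with union
the whole space. -/
def IsNontrivialCover {X : Type u} [TopologicalSpace X] (𝒰 : Set (Set X)) : Prop :=
  𝒰.Finite ∧ (∀ U ∈ 𝒰, IsOpen U ∧ ¬ Dense U) ∧ ⋃₀ 𝒰 = Set.univ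

/-- The least cardinality of a (finite) subcover of the cover `𝒲`. -/
noncomputable def coverNumber {X : Type u} (𝒲 : Set (Set X)) : ℕ∞ :=
  ⨅ (𝒱 : Set (Set X)) (_ : 𝒱 ⊆ 𝒲 ∧ ⋃₀ 𝒱 = Set.univ), 𝒱.encard

/-- The join `⋁_{a ∈ F} T^{-a} 𝒰`, consisting of the sets `⋂_{a ∈ F} T^{-a} (s a)` with
`s a ∈ 𝒰`. -/
def joinAlong {X : Type u} [TopologicalSpace X] (T : X ≃ₜ X) (𝒰 : Set (Set X)) (F : Set ℤ) :
    Set (Set X) :=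
  {W | ∃ s : ℤ → Set X, (∀ a ∈ F, s a ∈ 𝒰) ∧ W = ⋂ a ∈ F, (T ^ a : X ≃ₜ X) ⁻¹' (s a)}

/-- The complexity of the cover `𝒰` along a set `A = {a₁ < a₂ < ⋯}` of positive integers: the
limit of the non-decreasing cover numbers of the joins over the initial segments of `A`. -/
noncomputable def complexity {X : Type u} [TopologicalSpace X] (T : X ≃ₜ X) (𝒰 : Set (Set X))
    (A : Set ℤ) : ℕ∞ :=
  ⨆ n : ℕ, coverNumber (joinAlong T 𝒰 (A ∩ Set.Icc 1 (n : ℤ)))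

/-- `(X, T)` is strong scattering: every finite non-trivial open cover has infinite complexity
along every set of positive integers of positive upper Banach density. -/
def StrongScattering {X : Type u} [TopologicalSpace X] (T : X ≃ₜ X) : Prop :=
  ∀ 𝒰 : Set (Set X), IsNontrivialCover 𝒰 →
    ∀ A : Set ℤ, (∀ a ∈ A, 0 < a) → A ∈ posUpperBanach → complexity T 𝒰 A = ⊤

end Systems

end TopMixing

/-! ### Upper Banach density and difference sets -/

namespace TopMixing

open Filter MeasureTheory

/-! Everything rests on how large `diffSet S` is when `S` has positive upper Banach density. By
pigeonhole, among sufficiently many translates of `S` two meet (`exists_forall_sub_mem_diffSet`), so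
`diffSet S` meets the difference set of every infinite sequence. By Hindman's theorem it therefore
lies in every minimal idempotent and is central. Since `D`-sets have positive density and the return
times of `U ×ˢ U` to `V ×ˢ V` are those of `U` to `V`, this gives the inclusion of classes.

For the equivalence with strong scattering, the main input is a correspondence principle: each `F`
of positive density admits a `D`-set `S` such that `F - a` and `F - b` meet in positive density for
all `a, b ∈ S` (`exists_dSet_inter_posUpperBanach`). Transitivity along `S - S` then yields, by
induction, one point visiting any finite list of open sets at times in `F`. Bounded complexity along
`A` would provide finitely many names covering all orbits; they can be made constant on a subset of
`A` of positive density, and a point escaping each of these constants contradicts the covering.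
Conversely, if the return times of disjoint `U`, `V` miss `S - S`, no orbit sees both sets along
`S`, and a two-element cover has complexity at most 2. Isolated points need a separate argument.

The example is the orbit closure of the indicator of a set `P`. No two differences of `P` are
consecutive, so two return time sets are disjoint and weak mixing fails. Yet every return time set
contains `B, 2B, …, kB` for each `k` and some `B > 0` depending on `k`, which forces it to meet `S -
S`, again by pigeonhole. `P` is built in finite stages by adding translates of the current stage
whose mutual differences are widely separated. -/

theorem ncard_inter_Icc_le (A : Set ℤ) (N M : ℤ) (h : 0 ≤ M - N) :
    ((A ∩ Set.Icc N M).ncard : ℝ) ≤ ((M - N + 1 : ℤ) : ℝ) := by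
  have h1 : (A ∩ Set.Icc N M).ncard ≤ (Set.Icc N M).ncard :=
    Set.ncard_le_ncard Set.inter_subset_right (Set.finite_Icc N M)
  have h2 : (Set.Icc N M).ncard = (M + 1 - N).toNat := by
    rw [← Finset.coe_Icc, Set.ncard_coe_finset, Int.card_Icc]
  have h3 : ((A ∩ Set.Icc N M).ncard : ℤ) ≤ M - N + 1 := by omega
  exact_mod_cast h3

/-- Positive upper Banach density, unfolded: long intervals in which `A` has proportion at least
a fixed `δ > 0`. -/
theorem mem_posUpperBanach_iff {A : Set ℤ} :
    A ∈ posUpperBanach ↔ ∃ δ : ℝ, 0 < δ ∧ ∀ L : ℤ, ∃ N M : ℤ, L ≤ M - N ∧ 0 ≤ M - N ∧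
      δ * ((M - N + 1 : ℤ) : ℝ) ≤ ((A ∩ Set.Icc N M).ncard : ℝ) := by
  have key : ∀ P : ℤ × ℤ → Prop,
      (∃ᶠ p in Filter.comap (fun p : ℤ × ℤ => p.2 - p.1) Filter.atTop, P p) ↔
        ∀ L : ℤ, ∃ N M : ℤ, L ≤ M - N ∧ P (N, M) := by
    intro P
    rw [Filter.frequently_comap, Filter.frequently_atTop]
    constructor
    · intro h L
      obtain ⟨b, hb, a, rfl, ha⟩ := h L
      exact ⟨a.1, a.2, hb, ha⟩
    · intro h L
      obtain ⟨N, M, h1, h2⟩ := h L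
      exact ⟨M - N, h1, (N, M), rfl, h2⟩
  have hev : ∀ᶠ p in Filter.comap (fun p : ℤ × ℤ => p.2 - p.1) Filter.atTop,
      0 ≤ p.2 - p.1 := Filter.tendsto_comap.eventually (Filter.eventually_ge_atTop (0 : ℤ))
  have hne : (Filter.comap (fun p : ℤ × ℤ => p.2 - p.1) (Filter.atTop : Filter ℤ)).NeBot := by
    refine Filter.comap_neBot fun t ht => ?_
    obtain ⟨b, hb⟩ := Filter.nonempty_of_mem ht
    exact ⟨(0, b), by simpa using hb⟩
  constructor
  · intro h
    have hc : Filter.IsCoboundedUnder (· ≤ ·)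
        (Filter.comap (fun p : ℤ × ℤ => p.2 - p.1) (Filter.atTop : Filter ℤ))
        (fun p : ℤ × ℤ => ((A ∩ Set.Icc p.1 p.2).ncard : ℝ) / ((p.2 - p.1 + 1 : ℤ) : ℝ)) := by
      refine Filter.IsBoundedUnder.isCoboundedUnder_le ⟨0, Filter.eventually_map.2 ?_⟩
      filter_upwards [hev] with p hp
      have : (0 : ℝ) ≤ ((p.2 - p.1 + 1 : ℤ) : ℝ) := by exact_mod_cast (by omega)
      positivity
    have h1 : upperBanachDensity A / 2 < upperBanachDensity A := half_lt_self h
    have h2 := Filter.frequently_lt_of_lt_limsup hc h1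
    refine ⟨upperBanachDensity A / 2, half_pos h, fun L => ?_⟩
    obtain ⟨N, M, h3, h4⟩ := (key _).1 h2 (max L 0)
    have h5 : 0 ≤ M - N := (le_max_right _ _).trans h3
    refine ⟨N, M, (le_max_left _ _).trans h3, h5, ?_⟩
    have : (0 : ℝ) < ((M - N + 1 : ℤ) : ℝ) := by exact_mod_cast (by omega)
    exact ((lt_div_iff₀ this).1 h4).le
  · rintro ⟨δ, hδ, h⟩
    refine lt_of_lt_of_le hδ (Filter.le_limsup_of_frequently_le ((key _).2 fun L => ?_)
      ⟨1, Filter.eventually_map.2 ?_⟩)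
    · obtain ⟨N, M, h1, h2, h3⟩ := h L
      have : (0 : ℝ) < ((M - N + 1 : ℤ) : ℝ) := by exact_mod_cast (by omega)
      exact ⟨N, M, h1, (le_div_iff₀ this).2 h3⟩
    · filter_upwards [hev] with p hp
      have : (0 : ℝ) < ((p.2 - p.1 + 1 : ℤ) : ℝ) := by exact_mod_cast (by omega)
      rw [div_le_one this]
      exact ncard_inter_Icc_le A p.1 p.2 hp

theorem posUpperBanach_mono {A B : Set ℤ} (h : A ⊆ B) (hA : A ∈ posUpperBanach) :
    B ∈ posUpperBanach := by
  rw [mem_posUpperBanach_iff] at *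
  obtain ⟨δ, hδ, H⟩ := hA
  refine ⟨δ, hδ, fun L => ?_⟩
  obtain ⟨N, M, h1, h2, h3⟩ := H L
  refine ⟨N, M, h1, h2, h3.trans ?_⟩
  exact_mod_cast Set.ncard_le_ncard (Set.inter_subset_inter_left _ h)
    ((Set.finite_Icc N M).subset Set.inter_subset_right)

theorem posUpperBanach_union {A B : Set ℤ} (h : A ∪ B ∈ posUpperBanach) :
    A ∈ posUpperBanach ∨ B ∈ posUpperBanach := by
  by_contra! hc
  obtain ⟨hA, hB⟩ := hc
  rw [mem_posUpperBanach_iff] at *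
  push Not at hA hB
  obtain ⟨δ, hδ, H⟩ := h
  obtain ⟨L₁, h₁⟩ := hA (δ / 2) (half_pos hδ)
  obtain ⟨L₂, h₂⟩ := hB (δ / 2) (half_pos hδ)
  obtain ⟨N, M, h1, h2, h3⟩ := H (max L₁ L₂)
  have e1 := h₁ N M ((le_max_left _ _).trans h1) h2
  have e2 := h₂ N M ((le_max_right _ _).trans h1) h2
  have e3 : (((A ∪ B) ∩ Set.Icc N M).ncard : ℝ) ≤
      ((A ∩ Set.Icc N M).ncard : ℝ) + ((B ∩ Set.Icc N M).ncard : ℝ) := by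
    rw [Set.union_inter_distrib_right]
    exact_mod_cast Set.ncard_union_le _ _
  linarith

theorem posUpperBanach_preimage_add {A : Set ℤ} (t : ℤ) (hA : A ∈ posUpperBanach) :
    {m | m + t ∈ A} ∈ posUpperBanach := by
  rw [mem_posUpperBanach_iff] at *
  obtain ⟨δ, hδ, H⟩ := hA
  refine ⟨δ, hδ, fun L => ?_⟩
  obtain ⟨N, M, h1, h2, h3⟩ := H L
  refine ⟨N - t, M - t, by linarith, by linarith, ?_⟩
  have e : A ∩ Set.Icc N M = (fun m => m + t) '' ({m | m + t ∈ A} ∩ Set.Icc (N - t) (M - t)) := by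
    ext x
    simp only [Set.mem_inter_iff, Set.mem_Icc, Set.mem_image, Set.mem_ofPred_eq]
    constructor
    · rintro ⟨hx, h4, h5⟩
      exact ⟨x - t, ⟨by simpa using hx, by omega, by omega⟩, by omega⟩
    · rintro ⟨y, ⟨hy, h4, h5⟩, rfl⟩
      exact ⟨hy, by omega, by omega⟩
  rw [e, Set.ncard_image_of_injective _ (add_left_injective t)] at h3
  convert h3 using 3
  ring

theorem posUpperBanach_neg {A : Set ℤ} (hA : A ∈ posUpperBanach) :
    {m | -m ∈ A} ∈ posUpperBanach := by
  rw [mem_posUpperBanach_iff] at *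
  obtain ⟨δ, hδ, H⟩ := hA
  refine ⟨δ, hδ, fun L => ?_⟩
  obtain ⟨N, M, h1, h2, h3⟩ := H L
  refine ⟨-M, -N, by linarith, by linarith, ?_⟩
  have e : A ∩ Set.Icc N M = (fun m => -m) '' ({m | -m ∈ A} ∩ Set.Icc (-M) (-N)) := by
    ext x
    simp only [Set.mem_inter_iff, Set.mem_Icc, Set.mem_image, Set.mem_ofPred_eq]
    constructor
    · rintro ⟨hx, h4, h5⟩
      exact ⟨-x, ⟨by simpa using hx, by omega, by omega⟩, by omega⟩
    · rintro ⟨y, ⟨hy, h4, h5⟩, rfl⟩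
      exact ⟨hy, by omega, by omega⟩
  rw [e, Set.ncard_image_of_injective _ neg_injective] at h3
  convert h3 using 3
  ring

theorem infinite_of_mem_posUpperBanach {A : Set ℤ} (hA : A ∈ posUpperBanach) : A.Infinite := by
  intro hf
  rw [mem_posUpperBanach_iff] at hA
  obtain ⟨δ, hδ, H⟩ := hA
  obtain ⟨k, hk⟩ := exists_nat_gt ((A.ncard : ℝ) / δ)
  obtain ⟨N, M, h1, h2, h3⟩ := H k
  have h4 : ((A ∩ Set.Icc N M).ncard : ℝ) ≤ A.ncard := by
    exact_mod_cast Set.ncard_le_ncard Set.inter_subset_left hf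
  rw [div_lt_iff₀ hδ] at hk
  have h5 : (k : ℝ) ≤ ((M - N + 1 : ℤ) : ℝ) := by exact_mod_cast (by omega : (k : ℤ) ≤ M - N + 1)
  nlinarith

theorem posUpperBanach_multiples {g : ℤ} (hg : 0 < g) :
    {m : ℤ | 0 < m ∧ g ∣ m} ∈ posUpperBanach := by
  rw [mem_posUpperBanach_iff]
  refine ⟨1 / g, by positivity, fun L => ?_⟩
  set n : ℕ := L.toNat + 1
  have hn : L + 1 ≤ n ∧ (1 : ℤ) ≤ n := by omega
  have hgn : (n : ℤ) ≤ g * n := le_mul_of_one_le_left (by omega) (by omega)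
  refine ⟨1, g * n, ?_, ?_, ?_⟩
  · omega
  · omega
  · have e : (fun i : ℤ => g * i) '' (Set.Icc 1 (n : ℤ)) ⊆
        {m : ℤ | 0 < m ∧ g ∣ m} ∩ Set.Icc 1 (g * n) := by
      rintro _ ⟨i, ⟨h1, h2⟩, rfl⟩
      have : 0 < g * i := by positivity
      exact ⟨⟨this, dvd_mul_right _ _⟩, this, mul_le_mul_of_nonneg_left h2 hg.le⟩
    have e2 := Set.ncard_le_ncard e ((Set.finite_Icc 1 (g * n : ℤ)).subset Set.inter_subset_right)
    rw [Set.ncard_image_of_injective _ (mul_right_injective₀ hg.ne'), ← Finset.coe_Icc,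
      Set.ncard_coe_finset, Int.card_Icc] at e2
    have e3 : n ≤ ({m : ℤ | 0 < m ∧ g ∣ m} ∩ Set.Icc 1 (g * n)).ncard := by
      refine le_trans ?_ e2; omega
    have hg' : (0 : ℝ) < g := by exact_mod_cast hg
    have : 1 / (g : ℝ) * ((g * n - 1 + 1 : ℤ) : ℝ) = n := by
      push_cast; field_simp; ring
    rw [this]
    exact_mod_cast e3

/-- Among sufficiently many translates of a set of positive upper Banach density two intersect. -/
theorem exists_forall_sub_mem_diffSet {S : Set ℤ} (hS : S ∈ posUpperBanach) :
    ∃ k : ℕ, ∀ s : ℕ → ℤ, ∃ i j, i < j ∧ j < k ∧ (s i = s j ∨ s j - s i ∈ diffSet S) := by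
  rw [mem_posUpperBanach_iff] at hS
  obtain ⟨δ, hδ, H⟩ := hS
  obtain ⟨k, hk⟩ := exists_nat_gt (2 / δ)
  refine ⟨k, fun s => ?_⟩
  obtain ⟨R, hR⟩ : ∃ R : ℤ, ∀ i < k, |s i| ≤ R := by
    refine ⟨∑ i ∈ Finset.range k, |s i|, fun i hi => ?_⟩
    exact Finset.single_le_sum (f := fun i => |s i|) (fun _ _ => abs_nonneg _)
      (Finset.mem_range.2 hi)
  obtain ⟨N, M, h1, h2, h3⟩ := H (2 * R)
  have hfin : (S ∩ Set.Icc N M).Finite := (Set.finite_Icc N M).subset Set.inter_subset_right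
  -- The `k` translates contain more than `2l` points in all, where `l` is the length of the
  -- interval; they lie in an interval of length `l + 2R < 2l`.
  have hcard : (Finset.Icc (N - R) (M + R)).card < (Finset.range k ×ˢ hfin.toFinset).card := by
    rw [Finset.card_product, Finset.card_range, Int.card_Icc, ← Set.ncard_eq_toFinset_card _ hfin]
    set c := (S ∩ Set.Icc N M).ncard
    set l : ℤ := M - N + 1
    have hl : (0 : ℝ) < (l : ℝ) := by exact_mod_cast (by omega : 0 < l)
    rw [div_lt_iff₀ hδ] at hk
    have h4 : (2 : ℝ) * l < k * c := by
      have : (k : ℝ) * (δ * l) ≤ k * c := by gcongr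
      nlinarith
    have h5 : 2 * l < k * c := by exact_mod_cast h4
    zify
    omega
  obtain ⟨⟨i, x⟩, hx, ⟨j, y⟩, hy, hne, he⟩ :=
    Finset.exists_ne_map_eq_of_card_lt_of_maps_to (f := fun p : ℕ × ℤ => s p.1 + p.2) hcard (by
      rintro ⟨i, x⟩ hx
      simp only [Finset.coe_product, Set.mem_prod, Finset.coe_range, Set.mem_Iio,
        Set.Finite.coe_toFinset, Set.mem_inter_iff, Set.mem_Icc] at hx
      have := abs_le.1 (hR i hx.1)
      simp only [Finset.coe_Icc, Set.mem_Icc]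
      omega)
  simp only [Finset.mem_product, Finset.mem_range, Set.Finite.mem_toFinset,
    Set.mem_inter_iff] at hx hy he
  have main : ∀ i x j y, i < k → j < k → x ∈ S → y ∈ S → s i + x = s j + y → i < j →
      ∃ i j, i < j ∧ j < k ∧ (s i = s j ∨ s j - s i ∈ diffSet S) := by
    intro i x j y _ hj hx hy he hij
    refine ⟨i, j, hij, hj, ?_⟩
    by_cases hxy : x = y
    · left; omega
    · right; exact ⟨x, hx, y, hy, hxy, by omega⟩
  rcases lt_trichotomy i j with hij | hij | hij
  · exact main i x j y hx.1 hy.1 hx.2.1 hy.2.1 he hij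
  · subst hij
    exact absurd (by simpa using he) (fun h : x = y => hne (by rw [h]))
  · exact main j y i x hy.1 hx.1 hy.2.1 hx.2.1 he.symm hij

/-! ### Idempotents of `βℤ` -/

section
attribute [local instance] Ultrafilter.add Ultrafilter.addSemigroup

theorem mem_ultrafilter_add {p q : Ultrafilter ℤ} {A : Set ℤ} :
    A ∈ p + q ↔ {m | {n | m + n ∈ A} ∈ q} ∈ p := Iff.rfl

/-- A filter base consisting of sets of positive upper Banach density is contained in an
ultrafilter all of whose members have positive upper Banach density. -/
theorem exists_ultrafilter_posUpperBanach (l : Filter ℤ) (hl : ∀ A ∈ l, A ∈ posUpperBanach) :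
    ∃ p : Ultrafilter ℤ, (p : Filter ℤ) ≤ l ∧ ∀ A ∈ p, A ∈ posUpperBanach := by
  -- Sets that fail to have positive density form an ideal. An ultrafilter finer than the dual
  -- filter contains none of them.
  let d : Filter ℤ := Filter.comk (fun A => A ∉ posUpperBanach)
    (fun h => (infinite_of_mem_posUpperBanach h) Set.finite_empty)
    (fun _ ht _ hs h => ht (posUpperBanach_mono hs h))
    (fun _ hs _ ht h => (posUpperBanach_union h).elim hs ht)
  have : (l ⊓ d).NeBot := by
    rw [Filter.inf_neBot_iff]
    intro A hA D hD
    have hD' : Dᶜ ∉ posUpperBanach := hD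
    have h1 : A ∈ posUpperBanach := hl A hA
    have h2 : (A ∩ D) ∪ Dᶜ ∈ posUpperBanach := posUpperBanach_mono (fun x hx => by
      by_cases h : x ∈ D
      · exact Or.inl ⟨hx, h⟩
      · exact Or.inr h) h1
    exact (infinite_of_mem_posUpperBanach ((posUpperBanach_union h2).resolve_right hD')).nonempty
  refine ⟨Ultrafilter.of (l ⊓ d), (Ultrafilter.of_le _).trans inf_le_left, fun A hA => ?_⟩
  by_contra h
  have h1 : Aᶜ ∈ d := by simpa [d, Filter.mem_comk] using h
  exact Ultrafilter.compl_notMem_iff.2 hA ((Ultrafilter.of_le _).trans inf_le_right h1)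

theorem posUpperBanach_finite_partition {ι : Type*} [Finite ι] {A : Set ℤ}
    (hA : A ∈ posUpperBanach) (c : ℤ → ι) : ∃ i, {a ∈ A | c a = i} ∈ posUpperBanach := by
  obtain ⟨p, hp, hE⟩ := exists_ultrafilter_posUpperBanach (Filter.principal A)
    (fun B hB => posUpperBanach_mono hB hA)
  obtain ⟨i, hi⟩ := Ultrafilter.eq_pure_of_finite (p.map c)
  refine ⟨i, hE _ (Filter.inter_mem (hp (Filter.mem_principal_self A)) ?_)⟩
  have : {i} ∈ p.map c := by rw [hi]; exact rfl
  exact this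

/-- A decreasing sequence of sets of positive upper Banach density which is a base of a closed
subsemigroup of `βℤ` consists of `D`-sets. -/
theorem mem_dSets_of_semigroup_base (S : ℕ → Set ℤ) (hS : Antitone S)
    (hpos : ∀ n, S n ∈ posUpperBanach) (hadd : ∀ n, ∀ s ∈ S n, ∃ m, ∀ t ∈ S m, s + t ∈ S n)
    (n : ℕ) : S n ∈ dSets := by
  -- `E` is a non-empty compact subsemigroup, so the Ellis–Numakura lemma provides an idempotent in
  -- it.
  let E : Set (Ultrafilter ℤ) := {p | (∀ k, S k ∈ p) ∧ ∀ A ∈ p, A ∈ posUpperBanach}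
  have key := exists_idempotent_in_compact_add_subsemigroup
    (M := Ultrafilter ℤ) Ultrafilter.continuous_add_left E ?_ ?_ ?_
  · obtain ⟨p, hp, hpp⟩ := key
    exact ⟨p, hpp, hp.2, hp.1 n⟩
  · obtain ⟨p, hp, hE⟩ := exists_ultrafilter_posUpperBanach (⨅ k, Filter.principal (S k)) (by
      intro A hA
      rw [Filter.mem_iInf_of_directed
        (Antitone.directed_ge fun a b hab => Filter.principal_mono.2 (hS hab))] at hA
      obtain ⟨k, hk⟩ := hA
      exact posUpperBanach_mono hk (hpos k))
    exact ⟨p, fun k => hp (Filter.mem_iInf_of_mem k (Filter.mem_principal_self _)), hE⟩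
  · have : E = (⋂ k, {p : Ultrafilter ℤ | S k ∈ p}) ∩
        ⋂ (A : Set ℤ) (_ : A ∉ posUpperBanach), {p : Ultrafilter ℤ | Aᶜ ∈ p} := by
      ext p
      simp only [E, Set.mem_ofPred_eq, Set.mem_inter_iff, Set.mem_iInter,
        Ultrafilter.compl_mem_iff_notMem]
      exact and_congr_right fun _ => forall_congr' fun _ => not_imp_not.symm
    rw [this]
    exact IsClosed.isCompact ((isClosed_iInter fun _ => ultrafilter_isClosed_basic _).inter
      (isClosed_iInter fun _ => isClosed_iInter fun _ => ultrafilter_isClosed_basic _))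
  · rintro p ⟨hp, hp'⟩ q ⟨hq, hq'⟩
    refine ⟨fun k => ?_, fun A hA => ?_⟩
    · rw [mem_ultrafilter_add]
      filter_upwards [hp k] with s hs
      obtain ⟨m, hm⟩ := hadd k s hs
      filter_upwards [hq m] with t ht using hm t ht
    · rw [mem_ultrafilter_add] at hA
      -- A member of `p + q` contains a translate of a member of `q`, and density is translation
      -- invariant.
      obtain ⟨m, hm⟩ := p.nonempty_of_mem hA
      have h1 := posUpperBanach_preimage_add (-m) (hq' _ hm)
      refine posUpperBanach_mono (fun x hx => ?_) h1
      simpa using hx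

/-- The left ideal `βℤ + p` generated by `p`. -/
def leftIdealOf (p : Ultrafilter ℤ) : Set (Ultrafilter ℤ) :=
  Set.range fun q : Ultrafilter ℤ => q + p

theorem isLeftIdeal_leftIdealOf (p : Ultrafilter ℤ) : IsLeftIdeal (leftIdealOf p) := by
  refine ⟨⟨p + p, p, rfl⟩, ?_⟩
  rintro q _ ⟨r, rfl⟩
  exact ⟨q + r, add_assoc q r p⟩

theorem isCompact_leftIdealOf (p : Ultrafilter ℤ) : IsCompact (leftIdealOf p) :=
  isCompact_range (Ultrafilter.continuous_add_left p)

theorem leftIdealOf_subset {L : Set (Ultrafilter ℤ)} (hL : IsLeftIdeal L) {p : Ultrafilter ℤ}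
    (hp : p ∈ L) : leftIdealOf p ⊆ L := by
  rintro _ ⟨q, rfl⟩
  exact hL.2 q p hp

/-- Zorn's lemma is applied to compact left ideals only. This suffices because every left ideal
contains a compact one, `βℤ + q` for any of its elements `q`. -/
theorem exists_isMinimalLeftIdeal :
    ∃ p : Ultrafilter ℤ, IsMinimalLeftIdeal (leftIdealOf p) := by
  let 𝒮 : Set (Set (Ultrafilter ℤ)) := {L | IsLeftIdeal L ∧ IsCompact L}
  obtain ⟨L, hL⟩ := zorn_superset 𝒮 (by
    intro c hc hchain
    rcases c.eq_empty_or_nonempty with rfl | hne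
    · exact ⟨leftIdealOf (pure 0), ⟨isLeftIdeal_leftIdealOf _, isCompact_leftIdealOf _⟩, by simp⟩
    have hcl : ∀ L ∈ c, IsClosed L := fun L hL => (hc hL).2.isClosed
    refine ⟨⋂₀ c, ⟨⟨?_, ?_⟩, ?_⟩, fun s hs => Set.sInter_subset_of_mem hs⟩
    · have : Nonempty c := hne.to_subtype
      exact IsCompact.nonempty_sInter_of_directed_nonempty_isCompact_isClosed
        (fun a ha b hb => (hchain.total ha hb).elim
          (fun h => ⟨a, ha, subset_rfl, h⟩) (fun h => ⟨b, hb, h, subset_rfl⟩)) (fun L hL => (hc hL).1.1) (fun L hL => (hc hL).2) hcl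
    · intro q p hp L hL
      exact (hc hL).1.2 q p (hp L hL)
    · exact (isClosed_sInter hcl).isCompact)
  obtain ⟨p, hp⟩ := hL.prop.1.1
  have key : ∀ J : Set (Ultrafilter ℤ), IsLeftIdeal J → J ⊆ L → L ⊆ J := by
    intro J hJ hJL
    obtain ⟨q, hq⟩ := hJ.1
    have h1 : leftIdealOf q ⊆ J := leftIdealOf_subset hJ hq
    exact (hL.le_of_le ⟨isLeftIdeal_leftIdealOf q, isCompact_leftIdealOf q⟩
      (h1.trans hJL)).trans h1
  have hLp : leftIdealOf p = L := (leftIdealOf_subset hL.prop.1 hp).antisymm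
    (key _ (isLeftIdeal_leftIdealOf p) (leftIdealOf_subset hL.prop.1 hp))
  refine ⟨p, isLeftIdeal_leftIdealOf p, fun J hJ hJL => ?_⟩
  rw [hLp] at hJL ⊢
  exact hJL.antisymm (key J hJ hJL)

theorem exists_isMinimalIdempotent : ∃ p : Ultrafilter ℤ, IsMinimalIdempotent p := by
  obtain ⟨q, hq⟩ := exists_isMinimalLeftIdeal
  obtain ⟨p, hp, hpp⟩ := exists_idempotent_in_compact_add_subsemigroup
    (M := Ultrafilter ℤ) Ultrafilter.continuous_add_left (leftIdealOf q) hq.1.1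
    (isCompact_leftIdealOf q) (fun x _ y hy => hq.1.2 x y hy)
  exact ⟨p, hpp, leftIdealOf q, hq, hp⟩

/-- Members of minimal idempotents are infinite: the free ultrafilters form a left ideal. -/
theorem IsMinimalIdempotent.finite_notMem {p : Ultrafilter ℤ} (hp : IsMinimalIdempotent p)
    {A : Set ℤ} (hA : A.Finite) : A ∉ p := by
  obtain ⟨-, L, hL, hpL⟩ := hp
  let J : Set (Ultrafilter ℤ) := {q ∈ L | ∀ A : Set ℤ, A.Finite → A ∉ q}
  have hcanc : ∀ (A : Set ℤ) (m : ℤ), A.Finite → {n | m + n ∈ A}.Finite := fun A m hA =>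
    hA.preimage (add_right_injective m).injOn
  have hJ : IsLeftIdeal J := by
    refine ⟨⟨Filter.hyperfilter ℤ + p, hL.1.2 _ _ hpL, fun A hA h => ?_⟩, ?_⟩
    · rw [mem_ultrafilter_add] at h
      -- If `p` is principal, the sum is a translate of a free ultrafilter; otherwise `p` is itself
      -- free and contains no finite set.
      by_cases hinf : ∃ n, {n} ∈ p
      · obtain ⟨n, hn⟩ := hinf
        refine Filter.notMem_hyperfilter_of_finite (hA.preimage (add_left_injective n).injOn)
          (Filter.mem_of_superset h fun m hm => ?_)
        obtain ⟨x, hx, rfl⟩ := p.nonempty_of_mem (Filter.inter_mem hm hn)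
        exact hx
      · obtain ⟨m, hm⟩ := Ultrafilter.nonempty_of_mem h
        obtain ⟨x, -, hx⟩ := p.eq_pure_of_finite_mem (hcanc A m hA) hm
        exact hinf ⟨x, by rw [hx]; exact rfl⟩
    · rintro q r ⟨hr, hr'⟩
      refine ⟨hL.1.2 q r hr, fun A hA h => ?_⟩
      rw [mem_ultrafilter_add] at h
      obtain ⟨m, hm⟩ := q.nonempty_of_mem h
      exact hr' _ (hcanc A m hA) hm
  have h := hL.2 J hJ (fun q hq => hq.1)
  rw [← h] at hpL
  exact hpL.2 A hA

/-- The difference set of a set of positive upper Banach density belongs to every minimal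
idempotent. -/
theorem IsMinimalIdempotent.diffSet_mem {p : Ultrafilter ℤ} (hp : IsMinimalIdempotent p)
    {S : Set ℤ} (hS : S ∈ posUpperBanach) : diffSet S ∈ p := by
  by_contra hcon
  have h0 : (diffSet S)ᶜ ∩ {0}ᶜ ∈ p := Filter.inter_mem (Ultrafilter.compl_mem_iff_notMem.2 hcon)
    (Ultrafilter.compl_mem_iff_notMem.2 (hp.finite_notMem (Set.finite_singleton 0)))
  obtain ⟨a, ha⟩ := Hindman.exists_FS_of_large p hp.1 _ h0
  obtain ⟨k, hk⟩ := exists_forall_sub_mem_diffSet hS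
  -- Differences of partial sums of `a` are finite sums, hence lie in the set avoiding both `diffSet
  -- S` and `0`. Removing `0` excludes equal partial sums.
  obtain ⟨i, j, hij, -, h⟩ := hk (fun n => ∑ l ∈ Finset.range n, a.get l)
  have hsum : (∑ l ∈ Finset.range j, a.get l) - ∑ l ∈ Finset.range i, a.get l =
      ∑ l ∈ Finset.Ico i j, a.get l := (Finset.sum_Ico_eq_sub _ hij.le).symm
  have hmem := ha (Hindman.FS.finsetSum a (Finset.Ico i j) (Finset.nonempty_Ico.2 hij))
  rcases h with h | h
  · exact hmem.2 (by simp only [Set.mem_singleton_iff]; rw [← hsum, h, sub_self])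
  · exact hmem.1 (by rwa [← hsum])

theorem dSets_subset_posUpperBanach : dSets ⊆ posUpperBanach := by
  rintro A ⟨p, -, hp, hA⟩
  exact hp A hA

end

/-! ### Return times and the inclusion of classes -/

theorem mem_dual_diffFamily {G : Set ℤ} :
    G ∈ dual (diffFamily dSets) ↔ ∀ S ∈ dSets, (G ∩ diffSet S).Nonempty := by
  constructor
  · intro h S hS
    exact h _ ⟨S, hS, subset_rfl⟩
  · rintro h A ⟨S, hS, hA⟩
    exact (h S hS).mono (Set.inter_subset_inter_right _ hA)

theorem zpow_homeo_prod {X : Type u} [TopologicalSpace X] (T : X ≃ₜ X) (n : ℤ) (p : X × X) :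
    ((T.prodCongr T) ^ n : X × X ≃ₜ X × X) p = ((T ^ n : X ≃ₜ X) p.1, (T ^ n : X ≃ₜ X) p.2) := by
  induction n using Int.induction_on generalizing p with
  | zero => rfl
  | succ n ih => rw [zpow_add_one, zpow_add_one, Homeomorph.mul_apply, ih]; rfl
  | pred n ih => rw [zpow_sub_one, zpow_sub_one, Homeomorph.mul_apply, ih]; rfl

theorem returnTimes_prod {X : Type u} [TopologicalSpace X] (T : X ≃ₜ X) (U U' V V' : Set X) :
    returnTimes (T.prodCongr T) (U ×ˢ U') (V ×ˢ V') = returnTimes T U V ∩ returnTimes T U' V' := by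
  ext n
  constructor
  · rintro ⟨_, ⟨p, hp, rfl⟩, h⟩
    rw [zpow_homeo_prod] at h
    exact ⟨⟨_, ⟨p.1, hp.1, rfl⟩, h.1⟩, ⟨_, ⟨p.2, hp.2, rfl⟩, h.2⟩⟩
  · rintro ⟨⟨_, ⟨x, hx, rfl⟩, hx'⟩, ⟨_, ⟨y, hy, rfl⟩, hy'⟩⟩
    refine ⟨_, ⟨(x, y), ⟨hx, hy⟩, rfl⟩, ?_⟩
    rw [zpow_homeo_prod]
    exact ⟨hx', hy'⟩

theorem dual_centralSets_transitive {X : Type u} [TopologicalSpace X] (T : X ≃ₜ X)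
    (h : FMixing (dual centralSets) T) : FTransitive (dual (diffFamily dSets)) T := by
  intro U V hU hU' hV hV'
  rw [mem_dual_diffFamily]
  intro S hS
  obtain ⟨p, hp⟩ := exists_isMinimalIdempotent
  have := h (U ×ˢ U) (V ×ˢ V) (hU.prod hU) (hU'.prod hU') (hV.prod hV) (hV'.prod hV') (diffSet S)
    ⟨p, hp, hp.diffSet_mem (dSets_subset_posUpperBanach hS)⟩
  rwa [returnTimes_prod, Set.inter_self] at this

theorem weakMixing_of_dual_centralSets {X : Type u} [TopologicalSpace X] (T : X ≃ₜ X)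
    (h : FMixing (dual centralSets) T) : WeakMixing T := by
  intro U V hU hU' hV hV'
  obtain ⟨p, hp⟩ := exists_isMinimalIdempotent
  exact (h U V hU hU' hV hV' Set.univ ⟨p, hp, Filter.univ_mem⟩).mono Set.inter_subset_left

/-! ### A correspondence principle producing `D`-sets -/

section Correspondence

/-- The shift by `t` on two-sided binary sequences. -/
def shiftSeq (t : ℤ) (x : ℤ → Bool) : ℤ → Bool := fun i => x (i + t)

theorem shiftSeq_shiftSeq (s t : ℤ) (x : ℤ → Bool) :
    shiftSeq s (shiftSeq t x) = shiftSeq (s + t) x := by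
  funext i
  simp [shiftSeq, add_assoc]

theorem shiftSeq_zero (x : ℤ → Bool) : shiftSeq 0 x = x := by
  funext i
  simp [shiftSeq]

theorem continuous_shiftSeq (t : ℤ) : Continuous (shiftSeq t) :=
  continuous_pi fun i => continuous_apply (i + t)

theorem isClopen_coord (i : ℤ) (b : Bool) : IsClopen {y : ℤ → Bool | y i = b} :=
  (isClopen_discrete {b}).preimage (continuous_apply i)

/-- The proportion of `A` in the interval `[N, M]`. -/
noncomputable def proportion (A : Set ℤ) (N M : ℤ) : ℝ :=
  ((A ∩ Set.Icc N M).ncard : ℝ) / ((M - N + 1 : ℤ) : ℝ)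

/-- Only the two end points of the interval matter. This makes limits of empirical measures
shift-invariant. -/
theorem abs_proportion_succ_sub_le (A : Set ℤ) {N M : ℤ} (h : 0 ≤ M - N) :
    |proportion {i | i + 1 ∈ A} N M - proportion A N M| ≤ 1 / ((M - N + 1 : ℤ) : ℝ) := by
  have hl : (0 : ℝ) < ((M - N + 1 : ℤ) : ℝ) := by exact_mod_cast (by omega)
  have e : ({i | i + 1 ∈ A} ∩ Set.Icc N M).ncard = (A ∩ Set.Icc (N + 1) (M + 1)).ncard := by
    rw [← Set.ncard_image_of_injective _ (add_left_injective (1 : ℤ))]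
    congr 1
    ext x
    simp only [Set.mem_inter_iff, Set.mem_Icc, Set.mem_image, Set.mem_ofPred_eq]
    constructor
    · rintro ⟨y, ⟨hy, h4, h5⟩, rfl⟩
      exact ⟨hy, by omega, by omega⟩
    · rintro ⟨hx, h4, h5⟩
      exact ⟨x - 1, ⟨by simpa using hx, by omega, by omega⟩, by omega⟩
  have hf : ∀ a b : ℤ, (A ∩ Set.Icc a b).Finite := fun a b =>
    (Set.finite_Icc a b).subset Set.inter_subset_right
  have h1 : (A ∩ Set.Icc (N + 1) (M + 1)).ncard ≤ (A ∩ Set.Icc N M).ncard + 1 := by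
    refine (Set.ncard_le_ncard (t := insert (M + 1) (A ∩ Set.Icc N M)) ?_
      ((hf _ _).insert _)).trans (Set.ncard_insert_le _ _)
    rintro x ⟨hx, h4, h5⟩
    by_cases hxM : x = M + 1
    · exact Or.inl hxM
    · exact Or.inr ⟨hx, by omega, by omega⟩
  have h2 : (A ∩ Set.Icc N M).ncard ≤ (A ∩ Set.Icc (N + 1) (M + 1)).ncard + 1 := by
    refine (Set.ncard_le_ncard (t := insert N (A ∩ Set.Icc (N + 1) (M + 1))) ?_
      ((hf _ _).insert _)).trans (Set.ncard_insert_le _ _)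
    rintro x ⟨hx, h4, h5⟩
    by_cases hxM : x = N
    · exact Or.inl hxM
    · exact Or.inr ⟨hx, by omega, by omega⟩
  rw [proportion, proportion, e, ← sub_div, abs_div, abs_of_pos hl]
  gcongr
  rw [abs_le]
  have h1' : ((A ∩ Set.Icc (N + 1) (M + 1)).ncard : ℝ) ≤ (A ∩ Set.Icc N M).ncard + 1 := by
    exact_mod_cast h1
  have h2' : ((A ∩ Set.Icc N M).ncard : ℝ) ≤ (A ∩ Set.Icc (N + 1) (M + 1)).ncard + 1 := by
    exact_mod_cast h2
  constructor <;> linarith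

theorem exists_empirical_measure (x : ℤ → Bool) {N M : ℤ} (h : 0 ≤ M - N) :
    ∃ ν : ProbabilityMeasure (ℤ → Bool), ∀ C : Set (ℤ → Bool), MeasurableSet C →
      (ν C : ℝ) = proportion {i | shiftSeq i x ∈ C} N M := by
  have hne : (Finset.Icc N M : Set ℤ).Nonempty := ⟨N, by simp; omega⟩
  have hP : IsProbabilityMeasure (ProbabilityTheory.uniformOn (Finset.Icc N M : Set ℤ)) :=
    ProbabilityTheory.isProbabilityMeasure_uniformOn (Finset.finite_toSet _) hne
  have hmeas : Measurable fun i : ℤ => shiftSeq i x := measurable_from_top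
  refine ⟨⟨(ProbabilityTheory.uniformOn (Finset.Icc N M : Set ℤ)).map fun i => shiftSeq i x,
    Measure.isProbabilityMeasure_map hmeas.aemeasurable⟩, fun C hC => ?_⟩
  change ((((ProbabilityTheory.uniformOn (Finset.Icc N M : Set ℤ)).map
    fun i => shiftSeq i x) C).toNNReal : ℝ) = _
  rw [Measure.map_apply hmeas hC, ProbabilityTheory.uniformOn,
    ProbabilityTheory.cond_apply (Finset.measurableSet _), Measure.count_apply_finset,
    Int.card_Icc, Measure.count_apply_finite _ ((Finset.finite_toSet _).inter_of_left _)]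
  rw [proportion, ← Set.ncard_eq_toFinset_card _ ((Finset.finite_toSet _).inter_of_left _),
    Set.inter_comm, Finset.coe_Icc]
  have e : ((M + 1 - N).toNat : ℝ) = ((M - N + 1 : ℤ) : ℝ) := by
    have : ((M + 1 - N).toNat : ℤ) = M - N + 1 := by omega
    exact_mod_cast this
  rw [ENNReal.toNNReal_mul, NNReal.coe_mul, ENNReal.toNNReal_inv, NNReal.coe_inv, ← e,
    div_eq_inv_mul]
  rfl

/-- The correspondence principle: a set of positive upper Banach density gives a shift-invariant
probability measure on binary sequences. -/
theorem exists_invariant_measure {F : Set ℤ} (hF : F ∈ posUpperBanach) (x : ℤ → Bool)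
    (hx : ∀ i, x i = true ↔ i ∈ F) :
    ∃ μ : Measure (ℤ → Bool), IsProbabilityMeasure μ ∧
      MeasurePreserving (shiftSeq 1) μ μ ∧ 0 < μ {y | y 0 = true} ∧
      ∀ C : Set (ℤ → Bool), IsClopen C → 0 < μ C → {i | shiftSeq i x ∈ C} ∈ posUpperBanach := by
  obtain ⟨δ, hδ, H⟩ := mem_posUpperBanach_iff.1 hF
  choose N M hL h0 hd using fun n : ℕ => H n
  choose ν hν using fun n => exists_empirical_measure x (h0 n)
  let U : Ultrafilter ℕ := Filter.hyperfilter ℕ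
  have hU : (U : Filter ℕ) ≤ atTop := by
    rw [← Nat.cofinite_eq_atTop]; exact Filter.hyperfilter_le_cofinite
  have hlen : ∀ n, (0 : ℝ) < ((M n - N n + 1 : ℤ) : ℝ) := fun n => by
    have := h0 n
    exact_mod_cast (by omega)
  -- The space of probability measures on the compact sequence space is compact, so the empirical
  -- measures converge along an ultrafilter. Clopen sets have empty boundary, so their measures
  -- converge too.
  obtain ⟨μ, hμ⟩ : ∃ μ, Tendsto ν U (nhds μ) := ⟨(U.map ν).lim, Ultrafilter.le_nhds_lim (U.map ν)⟩
  have hclopen : ∀ C : Set (ℤ → Bool), IsClopen C →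
      Tendsto (fun n => proportion {i | shiftSeq i x ∈ C} (N n) (M n)) U (nhds (μ C : ℝ)) := by
    intro C hC
    have h1 := ProbabilityMeasure.tendsto_measure_of_isClopen_of_tendsto hμ hC
    have h2 := (NNReal.tendsto_coe.2 h1)
    refine h2.congr fun n => ?_
    exact hν n C hC.2.measurableSet
  have hpre : ∀ C : Set (ℤ → Bool), IsClopen C → μ (shiftSeq 1 ⁻¹' C) = μ C := by
    intro C hC
    have hC' : IsClopen (shiftSeq 1 ⁻¹' C) := hC.preimage (continuous_shiftSeq 1)
    have h1 := (hclopen _ hC').sub (hclopen _ hC)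
    have h2 : Tendsto (fun n => proportion {i | shiftSeq i x ∈ shiftSeq 1 ⁻¹' C} (N n) (M n) -
        proportion {i | shiftSeq i x ∈ C} (N n) (M n)) U (nhds 0) := by
      have h3 : Tendsto (fun n : ℕ => 1 / ((n : ℝ) + 1)) U (nhds 0) :=
        tendsto_one_div_add_atTop_nhds_zero_nat.mono_left hU
      refine squeeze_zero_norm (fun n => ?_) h3
      have h4 := abs_proportion_succ_sub_le {i | shiftSeq i x ∈ C} (h0 n)
      have e : {i | shiftSeq i x ∈ shiftSeq 1 ⁻¹' C} = {i | i + 1 ∈ {i | shiftSeq i x ∈ C}} := by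
        ext i
        simp [shiftSeq_shiftSeq, add_comm]
      rw [e, Real.norm_eq_abs]
      refine h4.trans (one_div_le_one_div_of_le (by positivity) ?_)
      have := hL n
      exact_mod_cast (by omega : (n : ℤ) + 1 ≤ M n - N n + 1)
    have h3 := tendsto_nhds_unique h1 h2
    exact NNReal.coe_injective (sub_eq_zero.1 h3)
  refine ⟨μ, inferInstance, ⟨(continuous_shiftSeq 1).measurable, ?_⟩, ?_, ?_⟩
  · have : IsProbabilityMeasure ((μ : Measure (ℤ → Bool)).map (shiftSeq 1)) :=
      Measure.isProbabilityMeasure_map (continuous_shiftSeq 1).measurable.aemeasurable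
    refine ext_of_generate_finite {s | IsClopen s} ?_ (fun s hs t ht _ => hs.inter ht) ?_ (by simp)
    · rw [BorelSpace.measurable_eq (α := ℤ → Bool)]
      exact isTopologicalBasis_isClopen.borel_eq_generateFrom
    · intro C hC
      rw [Measure.map_apply (continuous_shiftSeq 1).measurable hC.2.measurableSet]
      have := hpre C hC
      rw [ProbabilityMeasure.coeFn_def] at this
      exact (ENNReal.toNNReal_eq_toNNReal_iff' (measure_ne_top _ _) (measure_ne_top _ _)).1 this
  · have hC : IsClopen {y : ℤ → Bool | y 0 = true} :=
      isClopen_coord 0 true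
    have h1 : δ ≤ (μ {y : ℤ → Bool | y 0 = true} : ℝ) := by
      refine ge_of_tendsto (hclopen _ hC) (Eventually.of_forall fun n => ?_)
      have e : {i | shiftSeq i x ∈ {y : ℤ → Bool | y 0 = true}} = F := by
        ext i
        simp [shiftSeq, hx]
      rw [e, proportion, le_div_iff₀ (hlen n)]
      exact hd n
    rw [← ProbabilityMeasure.ennreal_coeFn_eq_coeFn_toMeasure]
    exact_mod_cast hδ.trans_le h1
  · intro C hC hpos
    rw [← ProbabilityMeasure.ennreal_coeFn_eq_coeFn_toMeasure] at hpos
    have hpos' : (0 : ℝ) < μ C := by exact_mod_cast hpos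
    refine mem_posUpperBanach_iff.2 ⟨μ C / 2, half_pos hpos', fun L => ?_⟩
    have h1 : ∀ᶠ n in (U : Filter ℕ), (μ C : ℝ) / 2 <
        proportion {i | shiftSeq i x ∈ C} (N n) (M n) :=
      (hclopen C hC).eventually (lt_mem_nhds (half_lt_self hpos'))
    obtain ⟨n, h2, h3⟩ := (h1.and (hU (eventually_ge_atTop L.toNat))).exists
    refine ⟨N n, M n, ?_, h0 n, ((lt_div_iff₀ (hlen n)).1 h2).le⟩
    have := hL n
    have h4 : L.toNat ≤ n := h3
    omega


/-- The frequency of visits of `x` to `C` up to time `n`. -/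
noncomputable def visitFrequency (C : Set (ℤ → Bool)) (n : ℕ) (x : ℤ → Bool) : ℝ :=
  (∑ i ∈ Finset.range (n + 1), C.indicator 1 (shiftSeq i x)) / (n + 1 : ℝ)

theorem visitFrequency_nonneg (C : Set (ℤ → Bool)) (n : ℕ) (x : ℤ → Bool) :
    0 ≤ visitFrequency C n x := by
  unfold visitFrequency
  have : 0 ≤ ∑ i ∈ Finset.range (n + 1), C.indicator (1 : (ℤ → Bool) → ℝ) (shiftSeq i x) :=
    Finset.sum_nonneg fun i _ => Set.indicator_nonneg (fun _ _ => zero_le_one) _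
  positivity

theorem indicator_one_le_one (C : Set (ℤ → Bool)) (x : ℤ → Bool) :
    C.indicator (1 : (ℤ → Bool) → ℝ) x ≤ 1 :=
  Set.indicator_le_self' (fun _ _ => zero_le_one) x

theorem visitFrequency_le_one (C : Set (ℤ → Bool)) (n : ℕ) (x : ℤ → Bool) :
    visitFrequency C n x ≤ 1 := by
  unfold visitFrequency
  rw [div_le_one (by positivity)]
  refine (Finset.sum_le_sum fun i _ => indicator_one_le_one C _).trans ?_
  simp

theorem measurable_visitFrequency {C : Set (ℤ → Bool)} (hC : MeasurableSet C) (n : ℕ) :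
    Measurable (visitFrequency C n) := by
  unfold visitFrequency
  refine Measurable.div_const (Finset.measurable_sum _ fun i _ => ?_) _
  exact (measurable_one.indicator hC).comp (continuous_shiftSeq i).measurable

theorem posUpperBanach_of_not_tendsto_visitFrequency {C : Set (ℤ → Bool)} {x : ℤ → Bool}
    (h : ¬ Tendsto (fun n => visitFrequency C n x) atTop (nhds 0)) :
    {i | shiftSeq i x ∈ C} ∈ posUpperBanach := by
  classical
  rw [Metric.tendsto_atTop] at h
  push Not at h
  obtain ⟨ε, hε, h⟩ := h
  refine mem_posUpperBanach_iff.2 ⟨ε, hε, fun L => ?_⟩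
  obtain ⟨n, hn, hd⟩ := h L.toNat
  refine ⟨0, n, by omega, by omega, ?_⟩
  rw [Real.dist_eq, sub_zero, abs_of_nonneg (visitFrequency_nonneg _ _ _), visitFrequency,
    le_div_iff₀ (by positivity)] at hd
  have e : (∑ i ∈ Finset.range (n + 1), C.indicator (1 : (ℤ → Bool) → ℝ) (shiftSeq i x)) =
      (((Finset.range (n + 1)).filter fun i : ℕ => shiftSeq i x ∈ C).card : ℝ) := by
    rw [Finset.card_filter]
    push_cast
    exact Finset.sum_congr rfl fun i _ => by simp [Set.indicator_apply]
  rw [e] at hd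
  push_cast
  rw [sub_zero]
  refine hd.trans ?_
  rw [← Set.ncard_coe_finset,
    ← Set.ncard_image_of_injective _ (Nat.cast_injective (R := ℤ))]
  refine Nat.cast_le.2
    (Set.ncard_le_ncard ?_ ((Set.finite_Icc (0 : ℤ) n).subset Set.inter_subset_right))
  rintro _ ⟨i, hi, rfl⟩
  simp only [Finset.coe_filter, Finset.mem_range, Set.mem_ofPred_eq] at hi
  exact ⟨hi.2, by simp, by simp; omega⟩

theorem measurePreserving_shiftSeq_nat {μ : Measure (ℤ → Bool)}
    (hμ : MeasurePreserving (shiftSeq 1) μ μ) (n : ℕ) :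
    MeasurePreserving (shiftSeq (n : ℤ)) μ μ := by
  induction n with
  | zero =>
    have : shiftSeq ((0 : ℕ) : ℤ) = id := by
      funext x
      simp [shiftSeq_zero]
    rw [this]
    exact MeasurePreserving.id μ
  | succ n ih =>
    have : shiftSeq ((n + 1 : ℕ) : ℤ) = shiftSeq 1 ∘ shiftSeq (n : ℤ) := by
      funext x
      simp [shiftSeq_shiftSeq, add_comm]
    rw [this]
    exact hμ.comp ih

theorem integral_visitFrequency {μ : Measure (ℤ → Bool)} [IsProbabilityMeasure μ]
    (hμ : MeasurePreserving (shiftSeq 1) μ μ) {C : Set (ℤ → Bool)} (hC : MeasurableSet C) (n : ℕ) :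
    ∫ x, visitFrequency C n x ∂μ = μ.real C := by
  have hm : ∀ i : ℕ, Measurable fun x => C.indicator (1 : (ℤ → Bool) → ℝ) (shiftSeq i x) :=
    fun i => (measurable_one.indicator hC).comp (continuous_shiftSeq i).measurable
  have h1 : ∀ i : ℕ, ∫ x, C.indicator (1 : (ℤ → Bool) → ℝ) (shiftSeq i x) ∂μ = μ.real C := by
    intro i
    have h2 := measurePreserving_shiftSeq_nat hμ i
    rw [← integral_indicator_one hC, ← integral_map h2.measurable.aemeasurable
      (f := C.indicator (1 : (ℤ → Bool) → ℝ))
      (measurable_one.indicator hC).aestronglyMeasurable, h2.map_eq]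
  simp only [visitFrequency]
  rw [integral_div, integral_finsetSum _ fun i _ => ?_]
  · simp only [h1, Finset.sum_const, Finset.card_range, nsmul_eq_mul]
    push_cast
    field_simp
  · refine Integrable.of_bound (hm i).aestronglyMeasurable 1 (Eventually.of_forall fun x => ?_)
    have h0 : 0 ≤ C.indicator (1 : (ℤ → Bool) → ℝ) (shiftSeq i x) :=
      Set.indicator_nonneg (fun _ _ => zero_le_one) _
    rw [Real.norm_eq_abs, abs_of_nonneg h0]
    exact indicator_one_le_one C _

/-- A strengthening of Poincaré recurrence that needs no ergodic theorem. Let `B` be the exceptional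
part of `C`. Once an orbit enters `B`, its later visits to `B` are visits to `C` and have frequency
tending to 0, so the frequency of `B` tends to 0 everywhere. Its integral is constantly the measure
of `B`, which is therefore 0. -/
theorem ae_not_tendsto_visitFrequency {μ : Measure (ℤ → Bool)} [IsProbabilityMeasure μ]
    (hμ : MeasurePreserving (shiftSeq 1) μ μ) {C : Set (ℤ → Bool)} (hC : MeasurableSet C) :
    ∀ᵐ x ∂μ, x ∈ C → ¬ Tendsto (fun n => visitFrequency C n x) atTop (nhds 0) := by
  set B : Set (ℤ → Bool) := C ∩ {x | Tendsto (fun n => visitFrequency C n x) atTop (nhds 0)}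
  have hB : MeasurableSet B :=
    hC.inter (measurableSet_tendsto (nhds 0) fun n => measurable_visitFrequency hC n)
  have hlim : ∀ x, Tendsto (fun n => visitFrequency B n x) atTop (nhds 0) := by
    intro x
    by_cases hx : ∃ m : ℕ, shiftSeq m x ∈ B
    · obtain ⟨m, hm⟩ := hx
      have h1 : Tendsto (fun n : ℕ => (m : ℝ) * (1 / ((n : ℝ) + 1)) +
          visitFrequency C n (shiftSeq m x)) atTop (nhds 0) := by
        have := (tendsto_one_div_add_atTop_nhds_zero_nat (𝕜 := ℝ)).const_mul (m : ℝ)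
        simpa using this.add hm.2
      refine squeeze_zero (fun n => visitFrequency_nonneg _ _ _) (fun n => ?_) h1
      rw [visitFrequency, visitFrequency, mul_one_div, ← add_div]
      gcongr
      have hnn : ∀ i : ℕ, 0 ≤ B.indicator (1 : (ℤ → Bool) → ℝ) (shiftSeq i x) := fun i =>
        Set.indicator_nonneg (fun _ _ => zero_le_one) _
      calc ∑ i ∈ Finset.range (n + 1), B.indicator (1 : (ℤ → Bool) → ℝ) (shiftSeq i x)
          ≤ ∑ i ∈ Finset.range (m + (n + 1)), B.indicator (1 : (ℤ → Bool) → ℝ) (shiftSeq i x) :=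
            Finset.sum_le_sum_of_subset_of_nonneg
              (Finset.range_mono (by omega)) fun i _ _ => hnn i
        _ = ∑ i ∈ Finset.range m, B.indicator (1 : (ℤ → Bool) → ℝ) (shiftSeq i x) +
            ∑ i ∈ Finset.range (n + 1),
              B.indicator (1 : (ℤ → Bool) → ℝ) (shiftSeq (m + i : ℕ) x) :=
            Finset.sum_range_add _ _ _
        _ ≤ m + ∑ i ∈ Finset.range (n + 1),
              C.indicator (1 : (ℤ → Bool) → ℝ) (shiftSeq i (shiftSeq m x)) := by
            refine add_le_add ?_ (Finset.sum_le_sum fun i _ => ?_)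
            · refine (Finset.sum_le_sum fun i _ => indicator_one_le_one B _).trans ?_
              simp
            · rw [shiftSeq_shiftSeq, Nat.cast_add, add_comm (m : ℤ)]
              exact Set.indicator_le_indicator_of_subset Set.inter_subset_left
                (fun _ => zero_le_one) _
    · push Not at hx
      have : (fun n => visitFrequency B n x) = fun _ => 0 := by
        funext n
        simp [visitFrequency, hx]
      rw [this]
      exact tendsto_const_nhds
  have h1 : Tendsto (fun n => ∫ x, visitFrequency B n x ∂μ) atTop (nhds (∫ _, (0 : ℝ) ∂μ)) :=
    tendsto_integral_of_dominated_convergence (fun _ => 1)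
      (fun n => (measurable_visitFrequency hB n).aestronglyMeasurable) (integrable_const _)
      (fun n => Eventually.of_forall fun x => by
        rw [Real.norm_eq_abs, abs_of_nonneg (visitFrequency_nonneg _ _ _)]
        exact visitFrequency_le_one _ _ _)
      (Eventually.of_forall hlim)
  simp only [integral_visitFrequency hμ hB, integral_zero] at h1
  have h2 : μ.real B = 0 := tendsto_nhds_unique tendsto_const_nhds h1
  have h3 : μ B = 0 := (measureReal_eq_zero_iff).1 h2
  filter_upwards [measure_eq_zero_iff_ae_notMem.1 h3] with x hx hxC ht
  exact hx ⟨hxC, ht⟩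

/-- Every set `F` of positive upper Banach density admits a `D`-set `S` such that any two
translates of `F` by elements of `S` intersect in a set of positive upper Banach density. -/
theorem exists_dSet_inter_posUpperBanach {F : Set ℤ} (hF : F ∈ posUpperBanach) :
    ∃ S ∈ dSets, ∀ a ∈ S, ∀ b ∈ S, {m | m + a ∈ F ∧ m + b ∈ F} ∈ posUpperBanach := by
  classical
  obtain ⟨μ, hP, hμ, h0, hC⟩ := exists_invariant_measure hF (fun i => decide (i ∈ F))
    (fun i => by simp)
  -- There are only countably many clopen sets, so almost every `x` is recurrent with positive
  -- density for all its clopen neighbourhoods at once.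
  have : Countable (TopologicalSpace.Clopens (ℤ → Bool)) :=
    TopologicalSpace.Clopens.countable_iff_secondCountable.2 inferInstance
  have hae : ∀ᵐ x ∂μ, ∀ C : TopologicalSpace.Clopens (ℤ → Bool), x ∈ (C : Set (ℤ → Bool)) →
      0 < μ C ∧ ¬ Tendsto (fun n => visitFrequency C n x) atTop (nhds 0) := by
    rw [ae_all_iff]
    intro C
    have h1 := ae_not_tendsto_visitFrequency hμ C.isClopen.2.measurableSet
    by_cases h2 : μ (C : Set (ℤ → Bool)) = 0
    · filter_upwards [measure_eq_zero_iff_ae_notMem.1 h2] with x hx hxC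
      exact absurd hxC hx
    · filter_upwards [h1] with x hx hxC
      exact ⟨pos_iff_ne_zero.2 h2, hx hxC⟩
  obtain ⟨x, hx0, hx⟩ := ((frequently_ae_mem_iff.2 h0.ne').and_eventually hae).exists
  have hx' : ∀ C : Set (ℤ → Bool), IsClopen C → x ∈ C → 0 < μ C ∧
      {i | shiftSeq i x ∈ C} ∈ posUpperBanach := by
    intro C hCl hxC
    obtain ⟨h1, h2⟩ := hx ⟨C, hCl⟩ hxC
    exact ⟨h1, posUpperBanach_of_not_tendsto_visitFrequency h2⟩
  -- Return times of `x` to its own central cylinders. They form a semigroup base: if `s` returns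
  -- `x` to a cylinder, then so does `s + t` whenever `t` returns `x` to a cylinder larger by `|s|`.
  let S : ℕ → Set ℤ := fun k => {t | ∀ i ∈ Finset.Icc (-k : ℤ) k, x (i + t) = x i}
  have hS : S 0 ∈ dSets := by
    refine mem_dSets_of_semigroup_base S ?_ ?_ ?_ 0
    · intro k l hkl t ht i hi
      rw [Finset.mem_Icc] at hi
      exact ht i (Finset.mem_Icc.2 ⟨by omega, by omega⟩)
    · intro k
      have h1 : IsClopen (⋂ i ∈ Finset.Icc (-k : ℤ) k, {y : ℤ → Bool | y i = x i}) :=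
        isClopen_biInter_finset fun i _ => isClopen_coord i (x i)
      refine posUpperBanach_mono (fun t ht => ?_) (hx' _ h1 (by simp)).2
      intro i hi
      exact Set.mem_iInter₂.1 ht i hi
    · intro k s hs
      refine ⟨k + s.natAbs, fun t ht i hi => ?_⟩
      have h1 := hs i hi
      rw [Finset.mem_Icc] at hi
      have h2 := ht (i + s) (Finset.mem_Icc.2 ⟨by omega, by omega⟩)
      rw [← add_assoc, h2, h1]
  have hmem : ∀ a ∈ S 0, x a = true := by
    intro a ha
    have := ha 0 (by simp)
    rw [zero_add] at this
    rw [this]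
    exact hx0
  refine ⟨S 0, hS, fun a ha b hb => ?_⟩
  have h1 : IsClopen ({y : ℤ → Bool | y a = true} ∩ {y | y b = true}) :=
    (isClopen_coord a true).inter (isClopen_coord b true)
  refine posUpperBanach_mono (fun m hm => ?_) (hC _ h1 (hx' _ h1 ⟨hmem a ha, hmem b hb⟩).1)
  have h2 : decide (a + m ∈ F) = true ∧ decide (b + m ∈ F) = true := hm
  rw [decide_eq_true_iff, decide_eq_true_iff] at h2
  exact ⟨by rw [add_comm]; exact h2.1, by rw [add_comm]; exact h2.2⟩

end Correspondence

/-! ### Equivalence with strong scattering -/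

section Scattering

variable {X : Type u} [TopologicalSpace X]

theorem zpow_add_homeo_apply (T : X ≃ₜ X) (m n : ℤ) (x : X) :
    (T ^ (m + n) : X ≃ₜ X) x = (T ^ m : X ≃ₜ X) ((T ^ n : X ≃ₜ X) x) := by
  rw [zpow_add, Homeomorph.mul_apply]

theorem zpow_homeo_fixed (T : X ≃ₜ X) {z : X} (h : T z = z) (n : ℤ) : (T ^ n : X ≃ₜ X) z = z := by
  induction n using Int.induction_on with
  | zero => rfl
  | succ n ih => rw [zpow_add_homeo_apply, zpow_one, h, ih]
  | pred n ih =>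
    have h1 : (T ^ (-1 : ℤ) : X ≃ₜ X) z = z := by
      conv_lhs => rw [← h]
      rw [zpow_neg_one]
      exact T.symm_apply_apply z
    rw [sub_eq_add_neg, zpow_add_homeo_apply, h1, ih]

theorem returnTimes_mono (T : X ≃ₜ X) {U U' V V' : Set X} (hU : U ⊆ U') (hV : V ⊆ V') :
    returnTimes T U V ⊆ returnTimes T U' V' :=
  fun _ hn => hn.mono (Set.inter_subset_inter (Set.image_mono hU) hV)

theorem mem_returnTimes (T : X ≃ₜ X) {U V : Set X} {n : ℤ} :
    n ∈ returnTimes T U V ↔ ∃ x ∈ U, (T ^ n : X ≃ₜ X) x ∈ V := by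
  constructor
  · rintro ⟨_, ⟨x, hx, rfl⟩, h⟩
    exact ⟨x, hx, h⟩
  · rintro ⟨x, hx, h⟩
    exact ⟨_, ⟨x, hx, rfl⟩, h⟩

theorem FTransitive.exists_inter_preimage {T : X ≃ₜ X}
    (hT : FTransitive (dual (diffFamily dSets)) T) {U V : Set X} (hU : IsOpen U) (hU' : U.Nonempty)
    (hV : IsOpen V) (hV' : V.Nonempty) {A : Set ℤ} (hA : A ∈ posUpperBanach) :
    ∃ d : ℤ, ∃ A' ⊆ A, A' ∈ posUpperBanach ∧ (∀ m ∈ A', m + d ∈ A) ∧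
      (U ∩ (T ^ d : X ≃ₜ X) ⁻¹' V).Nonempty := by
  obtain ⟨S, hS, hSA⟩ := exists_dSet_inter_posUpperBanach hA
  obtain ⟨d, hd, a, ha, b, hb, -, rfl⟩ := mem_dual_diffFamily.1 (hT U V hU hU' hV hV') S hS
  obtain ⟨x, hx, hx'⟩ := (mem_returnTimes T).1 hd
  refine ⟨a - b, {m | m + -b ∈ {m | m + a ∈ A ∧ m + b ∈ A}}, ?_,
    posUpperBanach_preimage_add (-b) (hSA a ha b hb), ?_, x, hx, hx'⟩
  · rintro m ⟨-, hm⟩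
    simpa using hm
  · rintro m ⟨hm, -⟩
    have : m + (a - b) = m + -b + a := by ring
    rwa [this]

/-- Two targets are merged at each step: for `d` and `A'` with `A'` and `A' + d` inside `A`, a visit
to `W ∩ T⁻ᵈ V` at a time `a ∈ A'` is a visit to `W` at `a` and to `V` at `a + d`. The density of
`A'` keeps the induction going. -/
theorem FTransitive.exists_forall_mem_visit {T : X ≃ₜ X}
    (hT : FTransitive (dual (diffFamily dSets)) T) (l : List (Set X))
    (hl : ∀ V ∈ l, IsOpen V ∧ V.Nonempty) {W : Set X} (hW : IsOpen W) (hW' : W.Nonempty)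
    {A : Set ℤ} (hA : A ∈ posUpperBanach) :
    ∃ x, ∀ V ∈ W :: l, ∃ a ∈ A, (T ^ a : X ≃ₜ X) x ∈ V := by
  induction l generalizing W A with
  | nil =>
    obtain ⟨w, hw⟩ := hW'
    obtain ⟨a, ha⟩ := (infinite_of_mem_posUpperBanach hA).nonempty
    refine ⟨(T ^ (-a) : X ≃ₜ X) w, fun V hV => ⟨a, ha, ?_⟩⟩
    rw [List.mem_singleton] at hV
    rw [← zpow_add_homeo_apply, add_neg_cancel, hV]
    exact hw
  | cons V l ih =>
    obtain ⟨hV, hV'⟩ := hl V List.mem_cons_self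
    obtain ⟨d, A', hA'A, hA', hd, hne⟩ := hT.exists_inter_preimage hW hW' hV hV' hA
    obtain ⟨x, hx⟩ := ih (fun V' h => hl V' (List.mem_cons_of_mem _ h))
      (hW.inter (hV.preimage (T ^ d : X ≃ₜ X).continuous)) hne hA'
    refine ⟨x, fun V' hV'mem => ?_⟩
    obtain ⟨a, ha, hxa⟩ := hx _ List.mem_cons_self
    rcases List.mem_cons.1 hV'mem with rfl | h
    · exact ⟨a, hA'A ha, hxa.1⟩
    rcases List.mem_cons.1 h with rfl | h
    · refine ⟨a + d, hd a ha, ?_⟩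
      rw [add_comm, zpow_add_homeo_apply]
      exact hxa.2
    · obtain ⟨b, hb, hxb⟩ := hx V' (List.mem_cons_of_mem _ h)
      exact ⟨b, hA'A hb, hxb⟩

theorem exists_cover_of_coverNumber_le [Nonempty X] (T : X ≃ₜ X) {𝒰 : Set (Set X)}
    (h𝒰 : 𝒰.Nonempty) {F : Set ℤ} {K : ℕ} (hK : coverNumber (joinAlong T 𝒰 F) ≤ K) :
    ∃ σ : Fin K → ℤ → 𝒰, ∀ x, ∃ j, ∀ a ∈ F, (T ^ a : X ≃ₜ X) x ∈ (σ j a : Set X) := by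
  classical
  have h1 : coverNumber (joinAlong T 𝒰 F) < (K + 1 : ℕ) :=
    hK.trans_lt (by exact_mod_cast Nat.lt_succ_self K)
  simp only [coverNumber, iInf_lt_iff] at h1
  obtain ⟨𝒱, ⟨hsub, hcov⟩, hcard⟩ := h1
  have hfin : 𝒱.Finite := Set.encard_lt_top_iff.1 (hcard.trans (by exact_mod_cast ENat.natCast_lt_top _))
  have : Fintype 𝒱 := hfin.fintype
  have hc : Fintype.card 𝒱 ≤ Fintype.card (Fin K) := by
    rw [Fintype.card_fin]
    rw [hfin.encard_eq_coe_toFinset_card] at hcard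
    have h2 : hfin.toFinset.card < K + 1 := by exact_mod_cast hcard
    rw [← Set.ncard_eq_toFinset_card _ hfin] at h2
    rw [← Nat.card_eq_fintype_card, Nat.card_coe_set_eq]
    omega
  obtain ⟨e⟩ := Function.Embedding.nonempty_of_card_le hc
  obtain ⟨U₀, hU₀⟩ := h𝒰
  choose s hs hW using fun W : 𝒱 => hsub W.2
  let g : 𝒱 → ℤ → 𝒰 := fun W a => if h : a ∈ F then ⟨s W a, hs W a h⟩ else ⟨U₀, hU₀⟩
  refine ⟨Function.extend e g (fun _ _ => ⟨U₀, hU₀⟩), fun x => ?_⟩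
  obtain ⟨W, hWV, hxW⟩ : x ∈ ⋃₀ 𝒱 := hcov ▸ Set.mem_univ x
  refine ⟨e ⟨W, hWV⟩, fun a ha => ?_⟩
  rw [e.injective.extend_apply]
  have h3 := hW ⟨W, hWV⟩
  simp only at h3
  rw [h3] at hxW
  simp only [g, dif_pos ha]
  exact Set.mem_iInter₂.1 hxW a ha

theorem FTransitive.strongScattering [Nonempty X] {T : X ≃ₜ X}
    (hT : FTransitive (dual (diffFamily dSets)) T) : StrongScattering T := by
  intro 𝒰 h𝒰 A hApos hA
  by_contra hne
  obtain ⟨K, hK⟩ := ENat.ne_top_iff_exists.1 hne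
  obtain ⟨x₀⟩ := ‹Nonempty X›
  have : Nonempty X := ⟨x₀⟩
  have h𝒰ne : 𝒰.Nonempty := by
    obtain ⟨U, hU, -⟩ : x₀ ∈ ⋃₀ 𝒰 := h𝒰.2.2 ▸ Set.mem_univ x₀
    exact ⟨U, hU⟩
  have hle : ∀ n : ℕ, coverNumber (joinAlong T 𝒰 (A ∩ Set.Icc 1 (n : ℤ))) ≤ K := fun n => by
    rw [hK]
    exact le_iSup (fun n : ℕ => coverNumber (joinAlong T 𝒰 (A ∩ Set.Icc 1 (n : ℤ)))) n
  choose σ hσ using fun n => exists_cover_of_coverNumber_le T h𝒰ne (hle n)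
  have : Finite 𝒰 := h𝒰.1.to_subtype
  -- The `K` names depend on the initial segment of `A`. Their limit along an ultrafilter exists
  -- because the cover is finite.
  have hc : ∀ a : ℤ, ∃ c : Fin K → 𝒰, ∀ᶠ n in (hyperfilter ℕ : Filter ℕ),
      (fun j => σ n j a) = c := by
    intro a
    obtain ⟨c, hc⟩ := Ultrafilter.eq_pure_of_finite ((hyperfilter ℕ).map fun n j => σ n j a)
    have : {c} ∈ (hyperfilter ℕ).map fun n j => σ n j a := by rw [hc]; exact rfl
    exact ⟨c, this⟩
  choose c hc using hc
  obtain ⟨i, hi⟩ := posUpperBanach_finite_partition hA c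
  have hV : ∀ j, IsOpen (closure (i j : Set X))ᶜ ∧ (closure (i j : Set X))ᶜ.Nonempty := by
    intro j
    refine ⟨isClosed_closure.isOpen_compl, ?_⟩
    rw [Set.nonempty_compl]
    exact fun h => (h𝒰.2.1 _ (i j).2).2 (dense_iff_closure_eq.2 h)
  -- On a subset of `A` of positive density the `j`-th limit name is constantly `i j`. The point `x`
  -- leaves the closure of each `i j` at some time `a j` of this subset.
  obtain ⟨x, hx⟩ := hT.exists_forall_mem_visit (List.ofFn fun j => (closure (i j : Set X))ᶜ)
    (fun V hVmem => by
      obtain ⟨j, rfl⟩ := List.mem_ofFn.1 hVmem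
      exact hV j) isOpen_univ Set.univ_nonempty hi
  choose a ha hxa using fun j =>
    hx _ (List.mem_cons_of_mem _ (List.mem_ofFn.2 ⟨j, rfl⟩))
  have hle' : (hyperfilter ℕ : Filter ℕ) ≤ atTop := by
    rw [← Nat.cofinite_eq_atTop]; exact hyperfilter_le_cofinite
  have hev : ∀ᶠ n in (hyperfilter ℕ : Filter ℕ),
      ∀ j, (fun j => σ n j (a j)) j = i j ∧ (a j).toNat ≤ n := by
    rw [eventually_all]
    intro j
    filter_upwards [hc (a j), hle' (eventually_ge_atTop (a j).toNat)] with n h1 h2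
    refine ⟨?_, h2⟩
    have h3 : σ n j (a j) = c (a j) j := congrFun h1 j
    change σ n j (a j) = i j
    rw [h3, (ha j).2]
  -- For this `n` the names agree with their limits at the finitely many times `a j`, all at most
  -- `n`; hence no name covers `x`.
  obtain ⟨n, hn⟩ := hev.exists
  obtain ⟨j, hj⟩ := hσ n x
  have h1 : a j ∈ A ∩ Set.Icc 1 (n : ℤ) := by
    refine ⟨(ha j).1, hApos _ (ha j).1, ?_⟩
    have := (hn j).2
    omega
  have h2 := hj (a j) h1
  have h3 : σ n j (a j) = i j := (hn j).1
  rw [h3] at h2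
  exact hxa j (subset_closure h2)

theorem exists_pos_diffSet_subset {S : Set ℤ} (hS : S ∈ posUpperBanach) :
    ∃ A : Set ℤ, (∀ a ∈ A, 0 < a) ∧ A ∈ posUpperBanach ∧ diffSet A ⊆ diffSet S := by
  have h1 : {a | a ∈ S ∧ 0 < a} ∪ {a | a ∈ S ∧ a ≤ 0} ∈ posUpperBanach :=
    posUpperBanach_mono (fun a ha => (lt_or_ge 0 a).imp (fun h => ⟨ha, h⟩) fun h => ⟨ha, h⟩) hS
  rcases posUpperBanach_union h1 with h | h
  · refine ⟨_, fun a ha => ha.2, h, ?_⟩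
    rintro _ ⟨a, ha, b, hb, hne, rfl⟩
    exact ⟨a, ha.1, b, hb.1, hne, rfl⟩
  -- The non-positive part is reflected by `s ↦ 1 - s`; the 1 makes the image of `0` positive.
  · refine ⟨_, ?_, posUpperBanach_preimage_add (-1) (posUpperBanach_neg h), ?_⟩
    · rintro a ⟨-, ha⟩
      omega
    · rintro _ ⟨a, ha, b, hb, hne, rfl⟩
      exact ⟨_, hb.1, _, ha.1, by omega, by omega⟩

/-- If the two sets did not meet, an orbit visiting `K ⊆ U` along `A` could never visit `K' ⊆ V`
along `A`. Then the two constant names cover `X`, and the complexity of `{Kᶜ, K'ᶜ}` is at most 2. -/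
theorem StrongScattering.returnTimes_inter_diffSet_of_disjoint [T2Space X] [RegularSpace X]
    {T : X ≃ₜ X} (hT : StrongScattering T) {U V : Set X} (hU : IsOpen U) (hU' : U.Nonempty)
    (hV : IsOpen V) (hV' : V.Nonempty) (hUV : Disjoint U V) {S : Set ℤ}
    (hS : S ∈ posUpperBanach) : (returnTimes T U V ∩ diffSet S).Nonempty := by
  obtain ⟨A, hApos, hA, hAS⟩ := exists_pos_diffSet_subset hS
  obtain ⟨x, hx⟩ := hU'
  obtain ⟨y, hy⟩ := hV'
  obtain ⟨K, hKx, hK, hKU⟩ := exists_mem_nhds_isClosed_subset (hU.mem_nhds hx)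
  obtain ⟨K', hKy, hK', hKV⟩ := exists_mem_nhds_isClosed_subset (hV.mem_nhds hy)
  by_contra hcon
  have hcov : IsNontrivialCover {Kᶜ, K'ᶜ} := by
    have hnd : ∀ {C : Set X} {z : X}, C ∈ nhds z → ¬ Dense Cᶜ := by
      intro C z hC hd
      obtain ⟨w, hw, hw'⟩ := mem_closure_iff_nhds.1 (hd z) C hC
      exact hw' hw
    refine ⟨(Set.finite_singleton _).insert _, ?_, ?_⟩
    · rintro W (rfl | rfl)
      · exact ⟨hK.isOpen_compl, hnd hKx⟩
      · exact ⟨hK'.isOpen_compl, hnd hKy⟩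
    · rw [Set.sUnion_pair, ← Set.compl_inter, ((hUV.mono hKU hKV).inter_eq), Set.compl_empty]
  have hle : complexity T {Kᶜ, K'ᶜ} A ≤ 2 := by
    refine iSup_le fun n => ?_
    set F := A ∩ Set.Icc 1 (n : ℤ)
    refine (iInf₂_le {⋂ a ∈ F, (T ^ a : X ≃ₜ X) ⁻¹' Kᶜ, ⋂ a ∈ F, (T ^ a : X ≃ₜ X) ⁻¹' K'ᶜ}
      ⟨?_, ?_⟩).trans ((Set.encard_insert_le _ _).trans ?_)
    · rw [Set.encard_singleton]
      norm_num
    · rintro W (rfl | rfl)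
      · exact ⟨fun _ => Kᶜ, fun _ _ => Or.inl rfl, rfl⟩
      · exact ⟨fun _ => K'ᶜ, fun _ _ => Or.inr rfl, rfl⟩
    · rw [Set.sUnion_pair, Set.eq_univ_iff_forall]
      intro z
      by_contra hz
      simp only [Set.mem_union, Set.mem_iInter, Set.mem_preimage, Set.mem_compl_iff, not_or,
        not_forall, not_not] at hz
      obtain ⟨⟨a, ha, hza⟩, ⟨b, hb, hzb⟩⟩ := hz
      have hab : b ≠ a := by
        rintro rfl
        exact Set.disjoint_left.1 hUV (hKU hza) (hKV hzb)
      refine hcon ⟨b - a, (mem_returnTimes T).2 ⟨_, hKU hza, ?_⟩,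
        hAS ⟨b, hb.1, a, ha.1, hab, rfl⟩⟩
      rw [← zpow_add_homeo_apply, sub_add_cancel]
      exact hKV hzb
  rw [hT _ hcov A hApos hA] at hle
  exact absurd hle (by decide)

theorem StrongScattering.fTransitive [T2Space X] [RegularSpace X] {T : X ≃ₜ X}
    (hT : StrongScattering T) : FTransitive (dual (diffFamily dSets)) T := by
  intro U V hU hU' hV hV'
  rw [mem_dual_diffFamily]
  intro S hS
  have hS' := dSets_subset_posUpperBanach hS
  by_cases hne : ∃ u ∈ U, ∃ v ∈ V, u ≠ v
  · obtain ⟨u, hu, v, hv, huv⟩ := hne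
    obtain ⟨A, B, hA, hB, huA, hvB, hAB⟩ := t2_separation huv
    exact (hT.returnTimes_inter_diffSet_of_disjoint (hU.inter hA) ⟨u, hu, huA⟩ (hV.inter hB)
      ⟨v, hv, hvB⟩ (hAB.mono Set.inter_subset_right Set.inter_subset_right) hS').mono
      (Set.inter_subset_inter_left _ (returnTimes_mono T Set.inter_subset_left
        Set.inter_subset_left))
  -- What remains is `U = V = {z}` with `z` isolated, where no disjoint pair can be taken inside `U`
  -- and `V`. Strong scattering turns out to force `X` to be a single point.
  push Not at hne
  obtain ⟨z, hz⟩ := hU'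
  obtain ⟨z', hz'⟩ := hV'
  obtain rfl : z = z' := hne z hz z' hz'
  have hUz : IsOpen ({z} : Set X) := by
    have : U = {z} := Set.eq_singleton_iff_unique_mem.2 ⟨hz, fun u hu => hne u hu z hz'⟩
    rwa [← this]
  by_cases hX : ∀ w, w = z
  · obtain ⟨a, ha, b, hb, hab⟩ := (infinite_of_mem_posUpperBanach hS').nontrivial
    refine ⟨a - b, (mem_returnTimes T).2 ⟨z, hz, ?_⟩, a, ha, b, hb, hab, rfl⟩
    rw [hX ((T ^ (a - b) : X ≃ₜ X) z)]
    exact hz'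
  exfalso
  push Not at hX
  obtain ⟨w, hw⟩ := hX
  by_cases hTz : T z = z
  · obtain ⟨n, hn, -⟩ := hT.returnTimes_inter_diffSet_of_disjoint hUz ⟨z, rfl⟩
      isClosed_singleton.isOpen_compl ⟨w, hw⟩ disjoint_compl_right hS'
    obtain ⟨x, rfl, hx⟩ := (mem_returnTimes T).1 hn
    exact hx (zpow_homeo_fixed T hTz n)
  have hTzo : IsOpen ({T z} : Set X) := by
    have := T.isOpenMap _ hUz
    rwa [Set.image_singleton] at this
  -- Applied to multiples of `g`, whose differences are multiples of `g`. A period `g` of `z` would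
  -- give `T z = z`; without a period, `g = 2` gives `T` to an odd power fixing `z`, which is itself
  -- a period up to sign.
  have key : ∀ g : ℤ, 0 < g → ∃ n, g ∣ n ∧ (T ^ n : X ≃ₜ X) z = T z := by
    intro g hg
    obtain ⟨n, hn, a, ha, b, hb, -, rfl⟩ := hT.returnTimes_inter_diffSet_of_disjoint hUz ⟨z, rfl⟩
      hTzo ⟨T z, rfl⟩ (by simpa using Ne.symm hTz) (posUpperBanach_multiples hg)
    obtain ⟨x, rfl, hx⟩ := (mem_returnTimes T).1 hn
    exact ⟨a - b, dvd_sub ha.2 hb.2, hx⟩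
  by_cases hper : ∃ g : ℤ, 0 < g ∧ (T ^ g : X ≃ₜ X) z = z
  · obtain ⟨g, hg, hgz⟩ := hper
    obtain ⟨_, ⟨k, rfl⟩, hk⟩ := key g hg
    rw [zpow_mul, zpow_homeo_fixed _ hgz] at hk
    exact hTz hk.symm
  · push Not at hper
    obtain ⟨_, ⟨k, rfl⟩, hk⟩ := key 2 two_pos
    have h1 : (T ^ (2 * k - 1) : X ≃ₜ X) z = z := by
      have h2 : (T ^ (1 + (2 * k - 1)) : X ≃ₜ X) z = T z := by rwa [add_sub_cancel]
      rw [zpow_add_homeo_apply, zpow_one] at h2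
      exact T.injective h2
    rcases lt_or_gt_of_ne (show 2 * k - 1 ≠ 0 by omega) with h | h
    · refine hper (-(2 * k - 1)) (by omega) ?_
      conv_lhs => rw [← h1]
      rw [← zpow_add_homeo_apply, neg_add_cancel]
      rfl
    · exact hper _ h h1

end Scattering

/-! ### A sparse set with recurrent patterns -/

section SparseSet

open scoped Pointwise

/-- Distinct elements of `(C - C) ∪ Γ` have distance greater than `R`. -/
def DiffSeparated (R : ℤ) (C Γ : Set ℤ) : Prop :=
  ∀ e ∈ (C - C) ∪ Γ, ∀ e' ∈ (C - C) ∪ Γ, |e - e'| ≤ R → e = e'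

/-- `Γ` lists in advance all gaps to be realised, so inserting a pair with gap `g ∈ Γ` creates no
unforeseen short difference. The other new differences are `±(c - y)` and `±(c + g - y)`. As `c` is
huge, they are far from the old ones and from those of opposite sign. Those of equal sign differ by
`y - y'` up to `0` or `±g`, which the old separation controls. -/
theorem DiffSeparated.exists_insert_pair {R : ℤ} {C : Finset ℤ} {Γ : Finset ℤ}
    (hΓ : ∀ g ∈ Γ, -g ∈ Γ) (hC : DiffSeparated R C Γ) (h0 : 0 ∈ C) {g : ℤ} (hg : g ∈ Γ) :
    ∃ c, DiffSeparated R ((insert c (insert (c + g) C) : Finset ℤ) : Set ℤ) Γ := by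
  obtain ⟨B, hB⟩ : ∃ B : ℤ, ∀ x ∈ C ∪ Γ, |x| ≤ B := by
    refine ⟨∑ x ∈ C ∪ Γ, |x|, fun x hx => ?_⟩
    exact Finset.single_le_sum (f := fun x : ℤ => |x|) (fun _ _ => abs_nonneg _) hx
  have hBC : ∀ x ∈ C, -B ≤ x ∧ x ≤ B := fun x hx => abs_le.1 (hB x (Finset.mem_union_left _ hx))
  have hBΓ : ∀ x ∈ Γ, -B ≤ x ∧ x ≤ B := fun x hx => abs_le.1 (hB x (Finset.mem_union_right _ hx))
  have hB0 : 0 ≤ B := by have := hBC 0 h0; omega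
  have hgB := hBΓ g hg
  refine ⟨10 * B + |R| + 1, ?_⟩
  set c := 10 * B + |R| + 1
  have hc : 10 * B + R < c ∧ 10 * B < c := by
    have := le_abs_self R
    have := abs_nonneg R
    omega
  -- an element of the new difference set is old or `± (c + f)` with `f` small
  have hcase : ∀ e ∈ ((((insert c (insert (c + g) C) : Finset ℤ) : Set ℤ) -
      ((insert c (insert (c + g) C) : Finset ℤ) : Set ℤ)) ∪ Γ : Set ℤ),
      (e ∈ ((C : Set ℤ) - C) ∪ Γ) ∨
        ∃ y ∈ C, ∃ ε : ℤ, (ε = 1 ∨ ε = -1) ∧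
          (e = ε * (c - y) ∨ e = ε * (c + g - y)) := by
    rintro e (⟨x, hx, y, hy, rfl⟩ | he)
    · have h00 : (0 : ℤ) ∈ ((C : Set ℤ) - C) := ⟨0, h0, 0, h0, by simp⟩
      simp only [Finset.coe_insert, Set.mem_insert_iff, Finset.mem_coe] at hx hy
      rcases hx with rfl | rfl | hx <;> rcases hy with rfl | rfl | hy
      · exact Or.inl (Or.inl (by simpa using h00))
      · exact Or.inl (Or.inr (by simpa using hΓ g hg))
      · exact Or.inr ⟨y, hy, 1, Or.inl rfl, Or.inl (by ring)⟩
      · exact Or.inl (Or.inr (by simpa using hg))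
      · exact Or.inl (Or.inl (by simpa using h00))
      · exact Or.inr ⟨y, hy, 1, Or.inl rfl, Or.inr (by ring)⟩
      · exact Or.inr ⟨x, hx, -1, Or.inr rfl, Or.inl (by ring)⟩
      · exact Or.inr ⟨x, hx, -1, Or.inr rfl, Or.inr (by ring)⟩
      · exact Or.inl (Or.inl ⟨x, hx, y, hy, rfl⟩)
    · exact Or.inl (Or.inr he)
  have hold : ∀ e ∈ ((C : Set ℤ) - C) ∪ Γ, -(2 * B) ≤ e ∧ e ≤ 2 * B := by
    rintro e (⟨x, hx, y, hy, rfl⟩ | he)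
    · have := hBC x hx
      have := hBC y hy
      dsimp only
      omega
    · have := hBΓ e he
      omega
  have hCC : ∀ y ∈ C, ∀ y' ∈ C, y - y' ∈ ((C : Set ℤ) - C) ∪ Γ :=
    fun y hy y' hy' => Or.inl ⟨y, hy, y', hy', rfl⟩
  intro e he e' he' hee
  rw [abs_le] at hee
  rcases hcase e he with h | ⟨y, hy, ε, hε, h⟩ <;> rcases hcase e' he' with h' | ⟨y', hy', ε', hε', h'⟩
  · exact hC e h e' h' (abs_le.2 hee)
  · have := hold e h
    have := hBC y' hy'
    rcases hε' with rfl | rfl <;> rcases h' with rfl | rfl <;> omega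
  · have := hold e' h'
    have := hBC y hy
    rcases hε with rfl | rfl <;> rcases h with rfl | rfl <;> omega
  · have hy1 := hBC y hy
    have hy2 := hBC y' hy'
    have h00 : (0 : ℤ) ∈ ((C : Set ℤ) - C) ∪ Γ := by simpa using hCC 0 h0 0 h0
    have k1 := hC _ (hCC y hy y' hy') 0 h00
    have k2 := hC _ (hCC y hy y' hy') g (Or.inr hg)
    have k3 := hC _ (hCC y hy y' hy') (-g) (Or.inr (hΓ g hg))
    simp only [abs_le] at k1 k2 k3
    rcases hε with rfl | rfl <;> rcases hε' with rfl | rfl <;> rcases h with rfl | rfl <;>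
      rcases h' with rfl | rfl <;> omega

theorem exists_diffSeparated {R : ℤ} {Γ : Finset ℤ} (hΓ : ∀ g ∈ Γ, -g ∈ Γ) (h0 : (0 : ℤ) ∈ Γ)
    (hsep : ∀ g ∈ Γ, ∀ g' ∈ Γ, |g - g'| ≤ R → g = g') (G : Finset ℤ) (hG : G ⊆ Γ) :
    ∃ C : Finset ℤ, 0 ∈ C ∧ DiffSeparated R C Γ ∧ ∀ g ∈ G, ∃ c ∈ C, c + g ∈ C := by
  induction G using Finset.induction_on with
  | empty =>
    refine ⟨{0}, by simp, ?_, by simp⟩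
    have : ((({0} : Finset ℤ) : Set ℤ) - (({0} : Finset ℤ) : Set ℤ)) ∪ Γ = (Γ : Set ℤ) := by
      simpa using h0
    unfold DiffSeparated
    rw [this]
    exact hsep
  | insert g G _ ih =>
    obtain ⟨C, hC0, hC, hCG⟩ := ih ((Finset.subset_insert _ _).trans hG)
    obtain ⟨c, hc⟩ := hC.exists_insert_pair hΓ hC0 (hG (Finset.mem_insert_self _ _))
    refine ⟨_, by simp [hC0], hc, fun g' hg' => ?_⟩
    rcases Finset.mem_insert.1 hg' with rfl | h
    · exact ⟨c, by simp, by simp⟩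
    · obtain ⟨d, hd, hd'⟩ := hCG g' h
      exact ⟨d, by simp [hd], by simp [hd']⟩

/-- Around `c`, the set `Q` looks like `P` around `0`, within distance `M`. -/
def LooksLike (Q P : Set ℤ) (M c : ℤ) : Prop :=
  ∀ i, |i| ≤ M → (c + i ∈ Q ↔ i ∈ P)

theorem LooksLike.trans {Q P P' : Set ℤ} {M M' c : ℤ} (h : LooksLike Q P M c)
    (h' : LooksLike P P' M' 0) (hM : M' ≤ M) : LooksLike Q P' M' c := by
  intro i hi
  have := h' i hi
  rw [zero_add] at this
  rw [h i (hi.trans hM), this]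

/-- No two differences of elements of `P` are consecutive. -/
def NoConsecutiveDiffs (P : Set ℤ) : Prop :=
  ∀ a ∈ P, ∀ b ∈ P, ∀ c ∈ P, ∀ d ∈ P, a - b ≠ c - d + 1

/-- Take `Q = P + C` with differences of `C` separated by more than `4M + 1`. An equation `a - b = c
- d + 1` in `Q` then forces the `C`-parts to cancel, leaving such an equation in `P`. Separation
also keeps the copies of `P` apart, so each looks like `P` near its centre. -/
theorem exists_extension {P : Finset ℤ} (hP : NoConsecutiveDiffs P) {M : ℤ}
    (hM : ∀ x ∈ P, |x| ≤ M) (hM0 : 0 ≤ M) (j : ℤ) (k : ℕ) :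
    ∃ Q : Finset ℤ, NoConsecutiveDiffs Q ∧ LooksLike Q P M 0 ∧
      ∃ B : ℤ, 0 < B ∧ ∀ u : ℕ, 1 ≤ u → u ≤ k →
        ∃ c, LooksLike Q P M c ∧ LooksLike Q P M (c + (B * u - j)) := by
  classical
  set R : ℤ := 4 * M + 1
  -- Large enough that `0` and the gaps `±(B u - j)` are pairwise more than `R` apart.
  set B : ℤ := R + 2 * |j| + 1
  let G : Finset ℤ := (Finset.Icc 1 k).image fun u : ℕ => B * u - j
  let Γ : Finset ℤ := insert 0 (G ∪ G.image Neg.neg)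
  have hj := abs_nonneg j
  have hjl := neg_abs_le j
  have hju := le_abs_self j
  have hΓc : ∀ g ∈ Γ, g = 0 ∨ ∃ u : ℤ, 1 ≤ u ∧ (g = B * u - j ∨ g = -(B * u - j)) := by
    intro g hg
    simp only [Γ, G, Finset.mem_insert, Finset.mem_union, Finset.mem_image, Finset.mem_Icc] at hg
    rcases hg with h | ⟨u, hu, rfl⟩ | ⟨_, ⟨u, hu, rfl⟩, rfl⟩
    · exact Or.inl h
    · exact Or.inr ⟨u, by exact_mod_cast hu.1, Or.inl rfl⟩
    · exact Or.inr ⟨u, by exact_mod_cast hu.1, Or.inr rfl⟩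
  have hB : 0 < B := by omega
  have hBu : ∀ u : ℤ, 1 ≤ u → B ≤ B * u := fun u hu => le_mul_of_one_le_right hB.le hu
  have hsep : ∀ g ∈ Γ, ∀ g' ∈ Γ, |g - g'| ≤ R → g = g' := by
    intro g hg g' hg' h
    rw [abs_le] at h
    rcases hΓc g hg with rfl | ⟨u, hu, hgu⟩ <;> rcases hΓc g' hg' with rfl | ⟨v, hv, hgv⟩
    · rfl
    · have := hBu v hv
      rcases hgv with rfl | rfl <;> omega
    · have := hBu u hu
      rcases hgu with rfl | rfl <;> omega
    · have h1 := hBu u hu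
      have h2 := hBu v hv
      rcases lt_trichotomy u v with huv | rfl | huv
      · have h3 := hBu (v - u) (by omega)
        rw [mul_sub] at h3
        rcases hgu with rfl | rfl <;> rcases hgv with rfl | rfl <;> omega
      · rcases hgu with rfl | rfl <;> rcases hgv with rfl | rfl <;> omega
      · have h3 := hBu (u - v) (by omega)
        rw [mul_sub] at h3
        rcases hgu with rfl | rfl <;> rcases hgv with rfl | rfl <;> omega
  obtain ⟨C, hC0, hC, hCG⟩ := exists_diffSeparated (R := R) (Γ := Γ) (by
      intro g hg
      simp only [Γ, Finset.mem_insert, Finset.mem_union, Finset.mem_image] at hg ⊢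
      rcases hg with rfl | h | ⟨x, h, rfl⟩
      · exact Or.inl (by simp)
      · exact Or.inr (Or.inr ⟨g, h, rfl⟩)
      · exact Or.inr (Or.inl (by simpa using h)))
    (by simp [Γ]) hsep G (fun g hg => by simp [Γ, hg])
  have hmem : ∀ x, x ∈ ((P + C : Finset ℤ) : Set ℤ) ↔ ∃ p ∈ P, ∃ c ∈ C, p + c = x := by
    intro x
    rw [Finset.mem_coe, Finset.mem_add]
  have hCC : ∀ a ∈ C, ∀ b ∈ C, a - b ∈ ((C : Set ℤ) - C) ∪ Γ :=
    fun a ha b hb => Or.inl ⟨a, ha, b, hb, rfl⟩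
  have hlook : ∀ c ∈ C, LooksLike ((P + C : Finset ℤ) : Set ℤ) P M c := by
    intro c hc i hi
    rw [hmem]
    constructor
    · rintro ⟨p, hp, c', hc', h⟩
      have h1 := hC _ (hCC c' hc' c hc) _ (hCC c hc c hc) (by
        have := abs_le.1 (hM p hp)
        have := abs_le.1 hi
        rw [abs_le]
        omega)
      have : p = i := by omega
      exact this ▸ hp
    · intro hi'
      exact ⟨i, hi', c, hc, add_comm _ _⟩
  refine ⟨P + C, ?_, hlook 0 hC0, B, hB, ?_⟩
  · intro x hx y hy z hz w hw h
    obtain ⟨p₁, hp₁, c₁, hc₁, rfl⟩ := (hmem x).1 hx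
    obtain ⟨p₂, hp₂, c₂, hc₂, rfl⟩ := (hmem y).1 hy
    obtain ⟨p₃, hp₃, c₃, hc₃, rfl⟩ := (hmem z).1 hz
    obtain ⟨p₄, hp₄, c₄, hc₄, rfl⟩ := (hmem w).1 hw
    have h1 := hC _ (hCC c₁ hc₁ c₂ hc₂) _ (hCC c₃ hc₃ c₄ hc₄) (by
      have := abs_le.1 (hM p₁ hp₁)
      have := abs_le.1 (hM p₂ hp₂)
      have := abs_le.1 (hM p₃ hp₃)
      have := abs_le.1 (hM p₄ hp₄)
      rw [abs_le]
      omega)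
    exact hP p₁ hp₁ p₂ hp₂ p₃ hp₃ p₄ hp₄ (by omega)
  · intro u hu hk
    obtain ⟨c, hc, hc'⟩ := hCG (B * u - j)
      (Finset.mem_image.2 ⟨u, Finset.mem_Icc.2 ⟨hu, hk⟩, rfl⟩)
    exact ⟨c, hlook c hc, hlook _ hc'⟩

/-- A sparse set of integers without consecutive differences, in which the pattern around `0`
recurs along shifted arithmetic progressions of every length. -/
theorem exists_sparse_set : ∃ P : Set ℤ, 0 ∈ P ∧ NoConsecutiveDiffs P ∧
    ∀ (M j : ℤ) (k : ℕ), ∃ B : ℤ, 0 < B ∧ ∀ u : ℕ, 1 ≤ u → u ≤ k →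
      ∃ c, LooksLike P P M c ∧ LooksLike P P M (c + (B * u - j)) := by
  classical
  let St := {s : Finset ℤ × ℤ // 0 ∈ s.1 ∧ NoConsecutiveDiffs s.1 ∧ 0 ≤ s.2 ∧ ∀ x ∈ s.1, |x| ≤ s.2}
  have hstep : ∀ (s : St) (t : ℤ × ℕ), ∃ s' : St, s.1.2 + 1 ≤ s'.1.2 ∧
      LooksLike s'.1.1 s.1.1 s.1.2 0 ∧ ∃ B : ℤ, 0 < B ∧ ∀ u : ℕ, 1 ≤ u → u ≤ t.2 →
        ∃ c, |c| + s.1.2 ≤ s'.1.2 ∧ |c + (B * u - t.1)| + s.1.2 ≤ s'.1.2 ∧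
          LooksLike s'.1.1 s.1.1 s.1.2 c ∧ LooksLike s'.1.1 s.1.1 s.1.2 (c + (B * u - t.1)) := by
    rintro ⟨⟨P, M⟩, hP0, hP, hM0, hM⟩ ⟨j, k⟩
    obtain ⟨Q, hQ, hQP, B, hB, h⟩ := exists_extension hP hM hM0 j k
    choose! c hc using h
    have hQ0 : (0 : ℤ) ∈ Q := by
      have := (hQP 0 (by simpa using hM0)).2 hP0
      simpa using this
    -- The new window contains `Q` and the windows of all the copies just created, so later stages
    -- cannot disturb them.
    let M' : ℤ := M + 1 + ∑ x ∈ Q, |x| +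
      ∑ u ∈ Finset.Icc 1 k, (|c u| + |c u + (B * u - j)|)
    have h1 : 0 ≤ ∑ x ∈ Q, |x| := Finset.sum_nonneg fun _ _ => abs_nonneg _
    have h2 : 0 ≤ ∑ u ∈ Finset.Icc 1 k, (|c u| + |c u + (B * u - j)|) :=
      Finset.sum_nonneg fun _ _ => by positivity
    have h3 : ∀ x ∈ Q, |x| ≤ ∑ x ∈ Q, |x| := fun x hx =>
      Finset.single_le_sum (f := fun x : ℤ => |x|) (fun _ _ => abs_nonneg _) hx
    refine ⟨⟨(Q, M'), hQ0, hQ, ?_, fun x hx => ?_⟩, ?_, hQP, B, hB, fun u hu hk => ?_⟩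
    · change 0 ≤ M'
      dsimp only at hM0
      omega
    · have := h3 x hx
      change |x| ≤ M'
      dsimp only at hM0
      omega
    · change M + 1 ≤ M'
      omega
    · have h4 : |c u| + |c u + (B * u - j)| ≤
          ∑ u ∈ Finset.Icc 1 k, (|c u| + |c u + (B * u - j)|) :=
        Finset.single_le_sum (f := fun u : ℕ => |c u| + |c u + (B * u - j)|)
          (fun _ _ => by positivity) (Finset.mem_Icc.2 ⟨hu, hk⟩)
      have h5 := abs_nonneg (c u)
      have h6 := abs_nonneg (c u + (B * u - j))
      refine ⟨c u, ?_, ?_, (hc u hu hk).1, (hc u hu hk).2⟩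
      · change |c u| + M ≤ M'
        omega
      · change |c u + (B * u - j)| + M ≤ M'
        omega
  choose next hnext1 hnext2 hnext3 using hstep
  let e : ℤ × ℕ ≃ ℕ := (nonempty_equiv_of_countable (α := ℤ × ℕ) (β := ℕ)).some
  -- Every pair `(j, k)` is treated infinitely often, hence also at a stage whose window exceeds a
  -- prescribed `M`.
  let task : ℕ → ℤ × ℕ := fun n => e.symm n.unpair.1
  have htask : ∀ (t : ℤ × ℕ) (N : ℕ), ∃ n, N ≤ n ∧ task n = t := fun t N =>
    ⟨Nat.pair (e t) N, Nat.right_le_pair _ _, by simp [task]⟩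
  let s₀ : St := ⟨({0}, 0), by simp, by
    intro a ha b hb c hc d hd
    simp only [Finset.coe_singleton, Set.mem_singleton_iff] at ha hb hc hd
    omega, le_rfl, by simp⟩
  let s : ℕ → St := fun n => Nat.rec s₀ (fun n s => next s (task n)) n
  have hs : ∀ n, s (n + 1) = next (s n) (task n) := fun n => rfl
  have hMlt : ∀ n, (s n).1.2 + 1 ≤ (s (n + 1)).1.2 := fun n => hnext1 _ _
  have hMmono : Monotone fun n => (s n).1.2 := monotone_nat_of_le_succ fun n => by
    have := hMlt n
    omega
  have hMge : ∀ n : ℕ, (n : ℤ) ≤ (s n).1.2 := by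
    intro n
    induction n with
    | zero => exact (s 0).2.2.2.1
    | succ n ih =>
      have := hMlt n
      push_cast
      omega
  have hlook : ∀ n m, n ≤ m → LooksLike (s m).1.1 (s n).1.1 (s n).1.2 0 := by
    intro n m hnm
    induction m, hnm using Nat.le_induction with
    | base => intro i _; simp
    | succ m hnm ih => exact (hnext2 (s m) (task m)).trans ih (hMmono hnm)
  have hsub : ∀ n m, n ≤ m → (s n).1.1 ⊆ (s m).1.1 := by
    intro n m hnm x hx
    have := (hlook n m hnm x ((s n).2.2.2.2 x hx)).2 hx
    simpa using this
  let P : Set ℤ := {x | ∃ n, x ∈ (s n).1.1}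
  have hPlook : ∀ n, LooksLike P (s n).1.1 (s n).1.2 0 := by
    intro n i hi
    rw [zero_add]
    constructor
    · rintro ⟨m, hm⟩
      have h1 := hsub m (max m n) (le_max_left _ _) hm
      have h2 := (hlook n (max m n) (le_max_right _ _) i hi).1
      rw [zero_add] at h2
      exact h2 h1
    · exact fun h => ⟨n, h⟩
  refine ⟨P, ⟨0, (s 0).2.1⟩, ?_, fun M j k => ?_⟩
  · rintro a ⟨na, ha⟩ b ⟨nb, hb⟩ c ⟨nc, hc⟩ d ⟨nd, hd⟩
    let n := max (max na nb) (max nc nd)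
    exact (s n).2.2.1 a (hsub na n (by omega) ha) b (hsub nb n (by omega) hb)
      c (hsub nc n (by omega) hc) d (hsub nd n (by omega) hd)
  · obtain ⟨n, hn, ht⟩ := htask (j, k) M.toNat
    obtain ⟨B, hB, h⟩ := hnext3 (s n) (task n)
    rw [ht] at h
    refine ⟨B, hB, fun u hu hk => ?_⟩
    obtain ⟨c, hc1, hc2, hc3, hc4⟩ := h u hu hk
    have hMn : M ≤ (s n).1.2 := by
      have := hMge n
      omega
    have key : ∀ c, |c| + (s n).1.2 ≤ (s (n + 1)).1.2 →
        LooksLike (s (n + 1)).1.1 (s n).1.1 (s n).1.2 c → LooksLike P P M c := by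
      intro c hc hl i hi
      have h1 := hPlook (n + 1) (c + i) ((abs_add_le c i).trans (by omega))
      have h2 := hl i (by omega)
      have h3 := hPlook n i (by omega)
      rw [zero_add] at h1 h3
      rw [h1, h2, h3]
    rw [hs, ht] at key
    exact ⟨c, key c hc1 hc3, key _ hc2 hc4⟩

end SparseSet

/-! ### The subshift generated by the sparse set -/

section Subshift

/-- The orbit closure of a two-sided binary sequence under the shift. -/
def orbitClosure (x : ℤ → Bool) : Set (ℤ → Bool) :=
  closure (Set.range fun t => shiftSeq t x)

theorem shiftSeq_mem_orbitClosure {x y : ℤ → Bool} (t : ℤ) (hy : y ∈ orbitClosure x) :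
    shiftSeq t y ∈ orbitClosure x := by
  refine map_mem_closure (continuous_shiftSeq t) hy ?_
  rintro _ ⟨s, rfl⟩
  exact ⟨t + s, (shiftSeq_shiftSeq t s x).symm⟩

/-- The shift on an orbit closure. -/
def subshift (x : ℤ → Bool) : orbitClosure x ≃ₜ orbitClosure x where
  toFun y := ⟨shiftSeq 1 y, shiftSeq_mem_orbitClosure 1 y.2⟩
  invFun y := ⟨shiftSeq (-1) y, shiftSeq_mem_orbitClosure (-1) y.2⟩
  left_inv y := Subtype.ext (by simp [shiftSeq_shiftSeq, shiftSeq_zero])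
  right_inv y := Subtype.ext (by simp [shiftSeq_shiftSeq, shiftSeq_zero])
  continuous_toFun := ((continuous_shiftSeq 1).comp continuous_subtype_val).subtype_mk _
  continuous_invFun := ((continuous_shiftSeq (-1)).comp continuous_subtype_val).subtype_mk _

theorem coe_subshift_zpow (x : ℤ → Bool) (n : ℤ) (y : orbitClosure x) :
    (((subshift x ^ n : orbitClosure x ≃ₜ orbitClosure x) y : orbitClosure x) : ℤ → Bool) =
      shiftSeq n y := by
  induction n using Int.induction_on generalizing y with
  | zero => exact (shiftSeq_zero _).symm
  | succ n ih =>
    rw [zpow_add_homeo_apply, ih, zpow_one, ← shiftSeq_shiftSeq]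
    rfl
  | pred n ih =>
    rw [sub_eq_add_neg, zpow_add_homeo_apply, ih, zpow_neg_one, ← shiftSeq_shiftSeq]
    rfl

/-- The point of the orbit closure of `x` given by the `t`-th shift of `x`. -/
def orbitPoint (x : ℤ → Bool) (t : ℤ) : orbitClosure x :=
  ⟨shiftSeq t x, subset_closure ⟨t, rfl⟩⟩

theorem subshift_zpow_orbitPoint (x : ℤ → Bool) (n t : ℤ) :
    (subshift x ^ n : orbitClosure x ≃ₜ orbitClosure x) (orbitPoint x t) =
      orbitPoint x (n + t) :=
  Subtype.ext ((coe_subshift_zpow x n _).trans (shiftSeq_shiftSeq n t x))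

theorem exists_window_of_isOpen {x : ℤ → Bool} {U : Set (orbitClosure x)} (hU : IsOpen U)
    (hU' : U.Nonempty) :
    ∃ m M : ℤ, ∀ y : orbitClosure x,
      (∀ i, |i| ≤ M → (y : ℤ → Bool) i = x (i + m)) → y ∈ U := by
  obtain ⟨O, hO, rfl⟩ := isOpen_induced_iff.1 hU
  obtain ⟨y, hy⟩ := hU'
  obtain ⟨_, hm, m, rfl⟩ := mem_closure_iff.1 y.2 O hO hy
  obtain ⟨I, w, hI, hI_sub⟩ := isOpen_pi_iff.1 hO _ hm
  refine ⟨m, ∑ i ∈ I, |i|, fun y hy => hI_sub fun i hi => ?_⟩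
  rw [hy i (Finset.single_le_sum (f := fun i : ℤ => |i|) (fun _ _ => abs_nonneg _) hi)]
  exact (hI i hi).2

theorem exists_shift_of_mem_orbitClosure {x : ℤ → Bool} (y : orbitClosure x) (a b : ℤ)
    (ha : (y : ℤ → Bool) a = true) (hb : (y : ℤ → Bool) b = true) :
    ∃ t, x (a + t) = true ∧ x (b + t) = true := by
  have hO : IsOpen {z : ℤ → Bool | z a = true ∧ z b = true} :=
    (isClopen_coord a true).2.inter (isClopen_coord b true).2
  obtain ⟨_, hz, t, rfl⟩ := mem_closure_iff.1 y.2 _ hO ⟨ha, hb⟩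
  exact ⟨t, hz⟩

theorem fTransitive_subshift {P : Set ℤ} {x : ℤ → Bool} (hx : ∀ i, x i = true ↔ i ∈ P)
    (hP : ∀ (M j : ℤ) (k : ℕ), ∃ B : ℤ, 0 < B ∧ ∀ u : ℕ, 1 ≤ u → u ≤ k →
      ∃ c, LooksLike P P M c ∧ LooksLike P P M (c + (B * u - j))) :
    FTransitive (dual (diffFamily dSets)) (subshift x) := by
  intro U V hU hU' hV hV'
  rw [mem_dual_diffFamily]
  intro S hS
  obtain ⟨k, hk⟩ := exists_forall_sub_mem_diffSet (dSets_subset_posUpperBanach hS)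
  obtain ⟨m, M, hm⟩ := exists_window_of_isOpen hU hU'
  obtain ⟨m', M', hm'⟩ := exists_window_of_isOpen hV hV'
  -- The copies around `c` and `c + (B u - (m' - m))` put the `U`-pattern at `c + m` and the
  -- `V`-pattern at `c + m + B u`.
  obtain ⟨B, hB, h⟩ := hP (|M| + |m| + |M'| + |m'|) (m' - m) k
  have hxx : ∀ a b : ℤ, (a ∈ P ↔ b ∈ P) → x a = x b := fun a b hab =>
    Bool.eq_iff_iff.2 (by rw [hx, hx, hab])
  have key : ∀ u : ℕ, 1 ≤ u → u ≤ k → B * u ∈ returnTimes (subshift x) U V := by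
    intro u hu huk
    obtain ⟨c, hc, hc'⟩ := h u hu huk
    have h1 := le_abs_self M
    have h2 := le_abs_self M'
    have h3 := abs_nonneg M
    have h4 := abs_nonneg M'
    have h5 := abs_nonneg m
    have h6 := abs_nonneg m'
    refine (mem_returnTimes _).2 ⟨orbitPoint x (c + m), hm _ fun i hi => ?_, ?_⟩
    · refine hxx _ _ ?_
      rw [← hc (i + m) ((abs_add_le i m).trans (by omega)), show i + (c + m) = c + (i + m) by ring]
    · rw [subshift_zpow_orbitPoint]
      refine hm' _ fun i hi => hxx _ _ ?_
      rw [← hc' (i + m') ((abs_add_le i m').trans (by omega)),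
        show i + (B * u + (c + m)) = c + (B * u - (m' - m)) + (i + m') by ring]
  -- Among the translates of `S` by `0, B, …, (k-1)B` two meet, so `B (j - i)` is a difference of
  -- `S` with `1 ≤ j - i ≤ k`.
  obtain ⟨i, j, hij, hjk, hs⟩ := hk fun i => B * i
  have hu : ((j - i : ℕ) : ℤ) = (j : ℤ) - i := by push_cast [hij.le]; rfl
  have hs' : B * ((j - i : ℕ) : ℤ) ∈ diffSet S := by
    rcases hs with hs | hs
    · have := mul_left_cancel₀ hB.ne' hs
      omega
    · rwa [hu, mul_sub]
  exact ⟨_, key (j - i) (by omega) (by omega), hs'⟩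

/-- Return times from the cylinder `y 0 = true` to itself are differences of `P`, and those to `y 1
= true` are differences of `P` minus 1. A common return time would give consecutive differences. -/
theorem not_weakMixing_subshift {P : Set ℤ} {x : ℤ → Bool} (hx : ∀ i, x i = true ↔ i ∈ P)
    (h0 : 0 ∈ P) (hP : NoConsecutiveDiffs P) : ¬ WeakMixing (subshift x) := by
  intro hW
  have hopen : ∀ i : ℤ, IsOpen {y : orbitClosure x | (y : ℤ → Bool) i = true} := fun i =>
    (isClopen_coord i true).2.preimage continuous_subtype_val
  have hne : ∀ i : ℤ, {y : orbitClosure x | (y : ℤ → Bool) i = true}.Nonempty := fun i =>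
    ⟨orbitPoint x (-i), by simp [orbitPoint, shiftSeq, hx, h0]⟩
  have hdiff : ∀ i n : ℤ, n ∈ returnTimes (subshift x) {y | (y : ℤ → Bool) 0 = true}
      {y | (y : ℤ → Bool) i = true} → ∃ a ∈ P, ∃ b ∈ P, n + i = a - b := by
    intro i n hn
    obtain ⟨y, hy, hyn⟩ := (mem_returnTimes _).1 hn
    rw [Set.mem_ofPred_eq, coe_subshift_zpow] at hyn
    obtain ⟨t, h1, h2⟩ := exists_shift_of_mem_orbitClosure y (i + n) 0 hyn hy
    exact ⟨_, (hx _).1 h1, _, (hx _).1 h2, by ring⟩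
  obtain ⟨n, hn⟩ := hW _ _ ((hopen 0).prod (hopen 0)) ((hne 0).prod (hne 0))
    ((hopen 0).prod (hopen 1)) ((hne 0).prod (hne 1))
  rw [returnTimes_prod] at hn
  obtain ⟨a, ha, b, hb, hab⟩ := hdiff 0 n hn.1
  obtain ⟨c, hc, d, hd, hcd⟩ := hdiff 1 n hn.2
  exact hP c hc d hd a ha b hb (by omega)

end Subshift

end TopMixing

theorem mainTheorem5 :
    (∀ (X : Type u) [MetricSpace X] [CompactSpace X] [Nonempty X] (T : X ≃ₜ X),
      TopMixing.FMixing (TopMixing.dual TopMixing.centralSets) T →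
        TopMixing.FTransitive (TopMixing.dual (TopMixing.diffFamily TopMixing.dSets)) T) ∧
    (∃ (X : Type) (_ : MetricSpace X) (_ : CompactSpace X) (_ : Nonempty X) (T : X ≃ₜ X),
      TopMixing.FTransitive (TopMixing.dual (TopMixing.diffFamily TopMixing.dSets)) T ∧
        ¬ TopMixing.WeakMixing T ∧
        ¬ TopMixing.FMixing (TopMixing.dual TopMixing.centralSets) T) ∧
    (∀ (X : Type u) [MetricSpace X] [CompactSpace X] [Nonempty X] (T : X ≃ₜ X),
      TopMixing.FTransitive (TopMixing.dual (TopMixing.diffFamily TopMixing.dSets)) T ↔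
        TopMixing.StrongScattering T) := by
  refine ⟨fun X _ _ _ T h => TopMixing.dual_centralSets_transitive T h, ?_,
    fun X _ _ _ T => ⟨fun h => h.strongScattering, fun h => h.fTransitive⟩⟩
  classical
  obtain ⟨P, h0, hP, hPP⟩ := TopMixing.exists_sparse_set
  let x : ℤ → Bool := fun i => decide (i ∈ P)
  have hx : ∀ i, x i = true ↔ i ∈ P := fun i => decide_eq_true_iff
  have hW := TopMixing.not_weakMixing_subshift hx h0 hP
  let _ : MetricSpace (TopMixing.orbitClosure x) :=
    TopologicalSpace.metrizableSpaceMetric (TopMixing.orbitClosure x)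
  exact ⟨TopMixing.orbitClosure x, inferInstance,
    isCompact_iff_compactSpace.1 isClosed_closure.isCompact, ⟨TopMixing.orbitPoint x 0⟩,
    TopMixing.subshift x, TopMixing.fTransitive_subshift hx hPP, hW,
    fun h => hW (TopMixing.weakMixing_of_dual_centralSets _ h)⟩
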